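/- **Setting.** Let $\mathcal X,\widetilde{\mathcal X},\mathcal Y$ be finite sets, $P_X$ a probability distribution on $\mathcal X$ and $P_{\widetilde XY|X}$ a (broadcast) channel from $\mathcal X$ to $\widetilde{\mathcal X}\times\mathcal Y$. Let $(X^n,\widetilde X^n,Y^n)$ be i.i.d. with law $P_XP_{\widetilde XY|X}$. Logarithms are natural, and entropy $H$ and mutual information $I$ are in nats. *Generated-secret (GS) model:* an encoder $f:\widetilde{\mathcal X}^n\to\mathcal W\times\mathcal S$ and a decoder $g:\mathcal W\times\mathcal Y^n\to\mathcal S$ with finite $\mathcal W,\mathcal S$; put $(W,S)=f(\widetilde X^n)$ and $\hat S=g(W,Y^n)$. *Chosen-secret (CS) model:* $S$ is uniform on a finite set $\mathcal S$ and independent of $(X^n,\widetilde X^n,Y^n)$; the encoder is $f:\widetilde{\mathcal X}^n\times\mathcal S\to\mathcal W$, and $W=f(\widetilde X^n,S)$, $\hat S=g(W,Y^n)$. A tuple $(R_s,R_\ell,R_w)\in\mathbb R^3$ is *achievable* for a model if for every $\delta>0$ there are $n\ge1$, an encoder and a decoder with $R_s=\frac1n\log|\mathcal S|$ and $$\Pr[S\neq\hat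 S]\le\delta,\quad I(S;W)\le\delta,\quad \tfrac1nI(X^n;W)\le R_\ell+\delta,\quad \tfrac1nH(S)\ge R_s-\delta,\quad \tfrac1n\log|\mathcal W|\le R_w+\delta .$$ The key-leakage-storage regions $\mathcal C_{\rm gs}$ and $\mathcal C_{\rm cs}$ are the closures of the sets of achievable tuples. For a finite set $\mathcal U$ and a channel $P_{U|\widetilde X}$ from $\widetilde{\mathcal X}$ to $\mathcal U$, let $(U,X,\widetilde X,Y)$ have the law $P_{U|\widetilde X}P_XP_{\widetilde XY|X}$, so that $U-\widetilde X-XY$ is a Markov chain. Let $$\mathcal R_{\rm gs}=\bigcup_{P_{U|\widetilde X}}\bigl\{(R_s,R_\ell,R_w):\ 0\le R_s\le I(U;Y),\ R_\ell\ge\max\{0,I(U;X)-I(U;Y)\},\ R_w\ge I(U;\widetilde X)-I(U;Y)\bigr\},$$ $$\mathcal R_{\rm cs}=\bigcup_{P_{U|\widetilde X}}\bigl\{(R_s,R_\ell,R_w):\ 0\le R_s\le I(U;Y),\ R_\ell\ge\max\{0,I(U;X)-I(U;Y)\},\ R_w\ge I(U;\widetilde X)\bigr\}.$$ Let $\mathcal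 R_1$ and $\mathcal R_2$ be the parts of the union $\mathcal R_{\rm gs}$ that come from the $P_{U|\widetilde X}$ for which $\max\{0,I(U;X)-I(U;Y)\}$ is positive and zero, respectively, and let $\mathcal R_3$ and $\mathcal R_4$ be the corresponding parts of $\mathcal R_{\rm cs}$. **Theorem.** 1. $\mathcal R_{\rm gs}\subseteq\mathcal C_{\rm gs}$ and $\mathcal R_{\rm cs}\subseteq\mathcal C_{\rm cs}$. 2. None of $\mathcal R_1,\mathcal R_2,\mathcal R_3,\mathcal R_4$ changes if the union is restricted to $|\mathcal U|\le|\widetilde{\mathcal X}|+2$. 3. For every $P_{U|\widetilde X}$ there is a $P_{U'|\widetilde X}$ with $|\mathcal U'|\le|\widetilde{\mathcal X}|+1$, $I(U';Y)=I(U;Y)$ and $I(U';\widetilde X)=I(U;\widetilde X)$. If $I(U;X)\le I(U;Y)$ for all $P_{U|\widetilde X}$, then $\mathcal R_2$ and $\mathcal R_4$ do not change if the union is restricted to $|\mathcal U|\le|\widetilde{\mathcal X}|+1$. -/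

import Mathlib

noncomputable section

namespace KeyAgreement

/-! ### Finite information theory (natural logarithms throughout) -/

/-- Shannon entropy of a distribution on a finite set, `-∑ p(a) log p(a)`. -/
def shannonEntropy {α : Type*} [Fintype α] (p : PMF α) : ℝ :=
  ∑ a, Real.negMulLog (p a).toReal

/-- Entropy `H(A)` of a random variable `A` on a discrete probability space `(Ω, p)`. -/
def rvEntropy {Ω α : Type*} [Fintype α] (p : PMF Ω) (A : Ω → α) : ℝ :=
  shannonEntropy (p.map A)

/-- Mutual information `I(A;B) = H(A) + H(B) - H(A,B)`. -/
def mutualInfo {Ω α β : Type*} [Fintype α] [Fintype β] (p : PMF Ω) (A : Ω → α) (B : Ω → β) : ℝ :=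
  rvEntropy p A + rvEntropy p B - rvEntropy p (fun ω => (A ω, B ω))

/-- Probability of an event. -/
def prob {Ω : Type*} (p : PMF Ω) (E : Set Ω) : ℝ := (p.toOuterMeasure E).toReal

/-- The `n`-fold product distribution `z ↦ ∏ i, p (z i)`. -/
def iid {α : Type*} [Fintype α] (p : PMF α) (n : ℕ) : PMF (Fin n → α) :=
  PMF.ofFintype (fun z => ∏ i, p (z i)) (by
    have h : ∑ a, p a = 1 := by rw [← tsum_fintype (L := .unconditional _)]; exact p.tsum_coe
    rw [← Fintype.piFinset_univ, ← Finset.prod_univ_sum]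
    simp [h])

section Model

variable {X Xt Y : Type*} [Fintype X] [Fintype Xt] [Fintype Y]

/-- Joint law of `(X, X̃, Y)`: `X ∼ P_X`, then `(X̃, Y)` is the output of the broadcast channel
`P_{X̃Y|X}` with input `X`. -/
def sourceLaw (PX : PMF X) (BC : X → PMF (Xt × Y)) : PMF (X × Xt × Y) :=
  PX.bind fun x => (BC x).map fun z => (x, z)

/-! ### Codes and achievability -/

/-- The conditions on a block length `n`, a key `S`, a key estimate `S'` (both with values in a set
of size `MS`) and helper data `W` (with values in a set of size `MW`) for the rate tuple
`R = (R_s, R_ℓ, R_w)` and the tolerance `δ`. -/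
def MeetsConstraints {Ω : Type*} (p : PMF Ω) {n MS MW : ℕ} (Xn : Ω → Fin n → X)
    (S S' : Ω → Fin MS) (W : Ω → Fin MW) (R : ℝ × ℝ × ℝ) (δ : ℝ) : Prop :=
  R.1 = Real.log MS / n ∧
  prob p {ω | S ω ≠ S' ω} ≤ δ ∧
  mutualInfo p S W ≤ δ ∧
  mutualInfo p Xn W / n ≤ R.2.1 + δ ∧
  R.1 - δ ≤ rvEntropy p S / n ∧
  Real.log MW / n ≤ R.2.2 + δ

/-- Generated-secret model: the encoder computes helper data and key from `X̃ⁿ`, the decoder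
estimates the key from the helper data and `Yⁿ`. -/
def AchievableGS (PX : PMF X) (BC : X → PMF (Xt × Y)) (R : ℝ × ℝ × ℝ) : Prop :=
  ∀ δ : ℝ, 0 < δ → ∃ (n MW MS : ℕ), 1 ≤ n ∧
    ∃ (f : (Fin n → Xt) → Fin MW × Fin MS) (g : Fin MW × (Fin n → Y) → Fin MS),
      MeetsConstraints (iid (sourceLaw PX BC) n)
        (fun z i => (z i).1)
        (fun z => (f fun i => (z i).2.1).2)
        (fun z => g ((f fun i => (z i).2.1).1, fun i => (z i).2.2))
        (fun z => (f fun i => (z i).2.1).1)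
        R δ

/-- Chosen-secret model: probability space of `n` source symbols together with an independent
key that is uniformly distributed. -/
def chosenLaw (PX : PMF X) (BC : X → PMF (Xt × Y)) (n MS : ℕ) [NeZero MS] :
    PMF ((Fin n → X × Xt × Y) × Fin MS) :=
  (iid (sourceLaw PX BC) n).bind fun z => (PMF.uniformOfFintype (Fin MS)).map fun s => (z, s)

/-- Chosen-secret model: the encoder computes helper data from `X̃ⁿ` and the given key, the decoder
estimates the key from the helper data and `Yⁿ`. -/
def AchievableCS (PX : PMF X) (BC : X → PMF (Xt × Y)) (R : ℝ × ℝ × ℝ) : Prop :=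
  ∀ δ : ℝ, 0 < δ → ∃ (n MW MS : ℕ) (_ : NeZero MS), 1 ≤ n ∧
    ∃ (f : (Fin n → Xt) × Fin MS → Fin MW) (g : Fin MW × (Fin n → Y) → Fin MS),
      MeetsConstraints (chosenLaw PX BC n MS)
        (fun ω i => (ω.1 i).1)
        (fun ω => ω.2)
        (fun ω => g (f (fun i => (ω.1 i).2.1, ω.2), fun i => (ω.1 i).2.2))
        (fun ω => f (fun i => (ω.1 i).2.1, ω.2))
        R δ

/-- Key-leakage-storage region of the generated-secret model. -/
def capacityGS (PX : PMF X) (BC : X → PMF (Xt × Y)) : Set (ℝ × ℝ × ℝ) :=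
  closure {R | AchievableGS PX BC R}

/-- Key-leakage-storage region of the chosen-secret model. -/
def capacityCS (PX : PMF X) (BC : X → PMF (Xt × Y)) : Set (ℝ × ℝ × ℝ) :=
  closure {R | AchievableCS PX BC R}

/-! ### The single-letter regions -/

/-- Joint law of `(U, (X, X̃, Y))`, where `U` is the output of the channel `P_{U|X̃} = Q` with input
`X̃`; thus `U - X̃ - (X, Y)` is a Markov chain. -/
def auxLaw (PX : PMF X) (BC : X → PMF (Xt × Y)) {m : ℕ} (Q : Xt → PMF (Fin m)) :
    PMF (Fin m × X × Xt × Y) :=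
  (sourceLaw PX BC).bind fun z => (Q z.2.1).map fun u => (u, z)

/-- `I(U;X)`. -/
def infoUX (PX : PMF X) (BC : X → PMF (Xt × Y)) {m : ℕ} (Q : Xt → PMF (Fin m)) : ℝ :=
  mutualInfo (auxLaw PX BC Q) (fun ω => ω.1) (fun ω => ω.2.1)

/-- `I(U;X̃)`. -/
def infoUXt (PX : PMF X) (BC : X → PMF (Xt × Y)) {m : ℕ} (Q : Xt → PMF (Fin m)) : ℝ :=
  mutualInfo (auxLaw PX BC Q) (fun ω => ω.1) (fun ω => ω.2.2.1)

/-- `I(U;Y)`. -/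
def infoUY (PX : PMF X) (BC : X → PMF (Xt × Y)) {m : ℕ} (Q : Xt → PMF (Fin m)) : ℝ :=
  mutualInfo (auxLaw PX BC Q) (fun ω => ω.1) (fun ω => ω.2.2.2)

/-- Rate tuples `(R_s, R_ℓ, R_w)` of the generated-secret model for a fixed `P_{U|X̃}`. -/
def ratesGS (PX : PMF X) (BC : X → PMF (Xt × Y)) {m : ℕ} (Q : Xt → PMF (Fin m)) :
    Set (ℝ × ℝ × ℝ) :=
  {R | 0 ≤ R.1 ∧ R.1 ≤ infoUY PX BC Q ∧
    max 0 (infoUX PX BC Q - infoUY PX BC Q) ≤ R.2.1 ∧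
    infoUXt PX BC Q - infoUY PX BC Q ≤ R.2.2}

/-- Rate tuples `(R_s, R_ℓ, R_w)` of the chosen-secret model for a fixed `P_{U|X̃}`. -/
def ratesCS (PX : PMF X) (BC : X → PMF (Xt × Y)) {m : ℕ} (Q : Xt → PMF (Fin m)) :
    Set (ℝ × ℝ × ℝ) :=
  {R | 0 ≤ R.1 ∧ R.1 ≤ infoUY PX BC Q ∧
    max 0 (infoUX PX BC Q - infoUY PX BC Q) ≤ R.2.1 ∧
    infoUXt PX BC Q ≤ R.2.2}

/-- `R_gs`: union over all finite alphabets of `U` and all `P_{U|X̃}`. -/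
def regionGS (PX : PMF X) (BC : X → PMF (Xt × Y)) : Set (ℝ × ℝ × ℝ) :=
  ⋃ (m : ℕ) (Q : Xt → PMF (Fin m)), ratesGS PX BC Q

/-- `R_cs`: union over all finite alphabets of `U` and all `P_{U|X̃}`. -/
def regionCS (PX : PMF X) (BC : X → PMF (Xt × Y)) : Set (ℝ × ℝ × ℝ) :=
  ⋃ (m : ℕ) (Q : Xt → PMF (Fin m)), ratesCS PX BC Q

/-- `R_1`, with `|U| ≤ k` (`k = ⊤`: no bound): the part of `R_gs` that comes from the `P_{U|X̃}`
for which `max {0, I(U;X) - I(U;Y)}` is positive. -/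
def region1 (PX : PMF X) (BC : X → PMF (Xt × Y)) (k : ℕ∞) : Set (ℝ × ℝ × ℝ) :=
  ⋃ (m : ℕ) (_ : (m : ℕ∞) ≤ k) (Q : Xt → PMF (Fin m))
    (_ : 0 < max 0 (infoUX PX BC Q - infoUY PX BC Q)), ratesGS PX BC Q

/-- `R_2`, with `|U| ≤ k`: the part of `R_gs` that comes from the `P_{U|X̃}` for which
`max {0, I(U;X) - I(U;Y)}` is zero. -/
def region2 (PX : PMF X) (BC : X → PMF (Xt × Y)) (k : ℕ∞) : Set (ℝ × ℝ × ℝ) :=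
  ⋃ (m : ℕ) (_ : (m : ℕ∞) ≤ k) (Q : Xt → PMF (Fin m))
    (_ : max 0 (infoUX PX BC Q - infoUY PX BC Q) = 0), ratesGS PX BC Q

/-- `R_3`, with `|U| ≤ k`: the part of `R_cs` that comes from the `P_{U|X̃}` for which
`max {0, I(U;X) - I(U;Y)}` is positive. -/
def region3 (PX : PMF X) (BC : X → PMF (Xt × Y)) (k : ℕ∞) : Set (ℝ × ℝ × ℝ) :=
  ⋃ (m : ℕ) (_ : (m : ℕ∞) ≤ k) (Q : Xt → PMF (Fin m))
    (_ : 0 < max 0 (infoUX PX BC Q - infoUY PX BC Q)), ratesCS PX BC Q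

/-- `R_4`, with `|U| ≤ k`: the part of `R_cs` that comes from the `P_{U|X̃}` for which
`max {0, I(U;X) - I(U;Y)}` is zero. -/
def region4 (PX : PMF X) (BC : X → PMF (Xt × Y)) (k : ℕ∞) : Set (ℝ × ℝ × ℝ) :=
  ⋃ (m : ℕ) (_ : (m : ℕ∞) ≤ k) (Q : Xt → PMF (Fin m))
    (_ : max 0 (infoUX PX BC Q - infoUY PX BC Q) = 0), ratesCS PX BC Q

end Model

end KeyAgreement

end

set_option linter.unusedSectionVars false

/-! Inner bounds. For a channel from X̃ to U, draw about exp(n I(U;X̃)) codewords i.i.d. from the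
n-fold law of U. The encoder quantizes x̃ⁿ to the index K of a codeword that suits it. The helper
data W is a random bin number of K, with about exp(n(I(U;X̃) - I(U;Y))) bins, so few enough wrong
codewords share the bin that yⁿ singles out K (`sum_binError_le`). The key is a further random hash
of K.

The encoder sees only x̃ⁿ, yet the codeword must also be typical with Xⁿ and Yⁿ. So it looks for an
admissible codeword: one for which the conditional probability, given x̃ⁿ, of joint typicality is at
least 1 - γ. Markov's inequality shows that few pairs are inadmissible (`sum_not_admissible_le`),
and a covering argument then finds an admissible codeword (`sum_failMass_le`).

Leakage and secrecy are two uses of one entropic leftover hash lemma (`leftover_hash`), which bounds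
log|σ| - H(S|Z) for a hash S. For every codebook, `marg_quantize_pair_le` makes K spread out. Given
Xⁿ its values have probability about exp(-n(I(U;X̃) - I(U;X))) or less, so the bin number leaks at
most about n max(0, I(U;X) - I(U;Y)). Given W they have probability about exp(-n I(U;Y)) or less, so
a key of any smaller rate is nearly uniform and independent of W. Chernoff bounds make all error
terms geometric in n, and `eventually_exists_code` collects the result. A chosen secret is sent by a
one-time pad with the generated key, which adds the key rate to the storage rate.

Alphabet bounds. I(U;A) equals H(A) minus a sum over u of a continuous positively homogeneous
function of the vector P(U = u, X̃ = ·), and these vectors sum to the law of X̃. Conversely, any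
nonnegative family with this sum comes from a channel. With k functions to preserve, Carathéodory's
argument takes place in dimension |X̃| + k, and connectedness of the orthant saves one more vector
(`exists_family_with_zero`). Three informations give |X̃| + 2, two give |X̃| + 1. -/

noncomputable section

namespace KeyAgreement

/-! ### Marginals and entropies of real-valued weights on finite sets -/

section Weights

variable {Ω α β : Type*} [Fintype Ω] [Fintype α] [Fintype β]

open Classical in
/-- Marginal of the weight `p` under the map `A`. -/
def marg (p : Ω → ℝ) (A : Ω → α) (a : α) : ℝ := ∑ ω, if A ω = a then p ω else 0

/-- Entropy of the map `A` under the weight `p`. -/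
def ent (p : Ω → ℝ) (A : Ω → α) : ℝ := ∑ a, Real.negMulLog (marg p A a)

/-- A nonnegative weight of total mass one. -/
structure IsWeight (p : Ω → ℝ) : Prop where
  nonneg : ∀ ω, 0 ≤ p ω
  sum_eq : ∑ ω, p ω = 1

lemma IsWeight.nonempty {p : Ω → ℝ} (hp : IsWeight p) : Nonempty Ω := by
  by_contra h
  rw [not_nonempty_iff] at h
  have := hp.sum_eq
  simp at this

lemma marg_nonneg {p : Ω → ℝ} (hp : ∀ ω, 0 ≤ p ω) (A : Ω → α) (a : α) : 0 ≤ marg p A a :=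
  Finset.sum_nonneg fun ω _ => by split_ifs <;> simp [hp]

lemma sum_marg_mul (p : Ω → ℝ) (A : Ω → α) (f : α → ℝ) :
    ∑ a, marg p A a * f a = ∑ ω, p ω * f (A ω) := by
  classical
  simp_rw [marg, Finset.sum_mul]
  rw [Finset.sum_comm]
  refine Finset.sum_congr rfl fun ω _ => ?_
  simp [ite_mul]

lemma sum_marg (p : Ω → ℝ) (A : Ω → α) : ∑ a, marg p A a = ∑ ω, p ω := by
  simpa using sum_marg_mul p A fun _ => 1

lemma IsWeight.marg {p : Ω → ℝ} (hp : IsWeight p) (A : Ω → α) : IsWeight (marg p A) :=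
  ⟨marg_nonneg hp.nonneg A, by rw [sum_marg, hp.sum_eq]⟩

lemma le_marg {p : Ω → ℝ} (hp : ∀ ω, 0 ≤ p ω) (A : Ω → α) (ω : Ω) : p ω ≤ marg p A (A ω) := by
  classical
  have := Finset.single_le_sum (f := fun ω' => if A ω' = A ω then p ω' else 0)
    (fun ω' _ => by split_ifs <;> simp [hp]) (Finset.mem_univ ω)
  simpa [marg] using this

lemma marg_pos {p : Ω → ℝ} (hp : ∀ ω, 0 ≤ p ω) (A : Ω → α) {ω : Ω} (h : 0 < p ω) :
    0 < marg p A (A ω) := h.trans_le (le_marg hp A ω)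

lemma marg_pair_le_left {p : Ω → ℝ} (hp : ∀ ω, 0 ≤ p ω) (A : Ω → α) (B : Ω → β) (a : α) (b : β) :
    marg p (fun ω => (A ω, B ω)) (a, b) ≤ marg p A a := by
  classical
  refine Finset.sum_le_sum fun ω _ => ?_
  by_cases h : A ω = a <;> by_cases h' : B ω = b <;> simp [h, h', hp]

lemma marg_pair_le_right {p : Ω → ℝ} (hp : ∀ ω, 0 ≤ p ω) (A : Ω → α) (B : Ω → β) (a : α) (b : β) :
    marg p (fun ω => (A ω, B ω)) (a, b) ≤ marg p B b := by
  classical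
  refine Finset.sum_le_sum fun ω _ => ?_
  by_cases h : A ω = a <;> by_cases h' : B ω = b <;> simp [h, h', hp]

lemma sum_marg_pair_left (p : Ω → ℝ) (A : Ω → α) (B : Ω → β) (b : β) :
    ∑ a, marg p (fun ω => (A ω, B ω)) (a, b) = marg p B b := by
  classical
  simp_rw [marg]
  rw [Finset.sum_comm]
  refine Finset.sum_congr rfl fun ω _ => ?_
  by_cases h : B ω = b <;> simp [h]

lemma sum_marg_pair_right (p : Ω → ℝ) (A : Ω → α) (B : Ω → β) (a : α) :
    ∑ b, marg p (fun ω => (A ω, B ω)) (a, b) = marg p A a := by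
  classical
  simp_rw [marg]
  rw [Finset.sum_comm]
  refine Finset.sum_congr rfl fun ω _ => ?_
  by_cases h : A ω = a <;> simp [h]

/-- An entropy is an expectation over the common space `Ω`. This lets entropy inequalities be
obtained from Jensen's inequality for the logarithm. -/
lemma ent_eq (p : Ω → ℝ) (A : Ω → α) : ent p A = -∑ ω, p ω * Real.log (marg p A (A ω)) := by
  rw [← sum_marg_mul p A fun a => Real.log (marg p A a), ← Finset.sum_neg_distrib]
  exact Finset.sum_congr rfl fun a _ => by rw [Real.negMulLog]; ring

/-- Jensen's inequality for the logarithm. -/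
lemma sum_mul_log_le {p f : Ω → ℝ} (hp : IsWeight p) (hf : ∀ ω, 0 < p ω → 0 < f ω) {C : ℝ}
    (hC : 0 < C) (h : ∑ ω, p ω * f ω ≤ C) : ∑ ω, p ω * Real.log (f ω) ≤ Real.log C := by
  have key : ∀ ω, p ω * Real.log (f ω) ≤ p ω * Real.log C + (p ω * f ω / C - p ω) := by
    intro ω
    rcases (hp.nonneg ω).eq_or_lt with h0 | h0
    · simp [← h0]
    have hfω := hf ω h0
    have h1 := Real.log_le_sub_one_of_pos (div_pos hfω hC)
    rw [Real.log_div hfω.ne' hC.ne'] at h1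
    have h2 := mul_le_mul_of_nonneg_left h1 h0.le
    have h3 : p ω * (f ω / C - 1) = p ω * f ω / C - p ω := by ring
    linarith
  refine (Finset.sum_le_sum fun ω _ => key ω).trans ?_
  rw [Finset.sum_add_distrib, Finset.sum_sub_distrib, ← Finset.sum_mul, hp.sum_eq,
    ← Finset.sum_div, one_mul]
  have : (∑ ω, p ω * f ω) / C ≤ 1 := (div_le_one hC).2 h
  linarith

lemma sum_mul_log_nonpos {p f : Ω → ℝ} (hp : IsWeight p) (hf : ∀ ω, 0 < p ω → 0 < f ω)
    (h : ∑ ω, p ω * f ω ≤ 1) : ∑ ω, p ω * Real.log (f ω) ≤ 0 := by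
  simpa using sum_mul_log_le hp hf one_pos h

/-- A likelihood ratio has mean at most the mass of its numerator. Equality can fail because `f` may
charge points that `A` almost surely avoids. -/
lemma sum_div_marg_mul_le {p : Ω → ℝ} (hp : IsWeight p) (A : Ω → α) {f : α → ℝ}
    (hf : ∀ a, 0 ≤ f a) : ∑ ω, p ω * (f (A ω) / marg p A (A ω)) ≤ ∑ a, f a := by
  rw [← sum_marg_mul p A fun a => f a / marg p A a]
  refine Finset.sum_le_sum fun a _ => ?_
  rcases (marg_nonneg hp.nonneg A a).eq_or_lt with h | h
  · simp [← h, hf]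
  · rw [mul_div_cancel₀ _ h.ne']

lemma ent_le_log_card {p : Ω → ℝ} (hp : IsWeight p) (A : Ω → α) :
    ent p A ≤ Real.log (Fintype.card α) := by
  have hne : Nonempty α := hp.nonempty.map A
  have hc : (0 : ℝ) < Fintype.card α := by exact_mod_cast Fintype.card_pos
  have h := sum_mul_log_le (f := fun ω => 1 / marg p A (A ω)) hp
    (fun ω h => one_div_pos.2 (marg_pos hp.nonneg A h)) hc
    ((sum_div_marg_mul_le hp A (f := fun _ => 1) (by simp)).trans (by simp))
  rw [ent_eq, ← Finset.sum_neg_distrib]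
  refine le_trans (le_of_eq (Finset.sum_congr rfl fun ω _ => ?_)) h
  simp

/-- Jensen's inequality for the ratio of the product of the marginals to the joint law, whose mean
is at most one. -/
lemma ent_pair_le {p : Ω → ℝ} (hp : IsWeight p) (A : Ω → α) (B : Ω → β) :
    ent p (fun ω => (A ω, B ω)) ≤ ent p A + ent p B := by
  have h := sum_mul_log_nonpos
    (f := fun ω => marg p A (A ω) * marg p B (B ω) / marg p (fun ω => (A ω, B ω)) (A ω, B ω)) hp
    (fun ω h => by
      have h1 := marg_pos hp.nonneg A h
      have h2 := marg_pos hp.nonneg B h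
      have h3 := marg_pos hp.nonneg (fun ω => (A ω, B ω)) h
      positivity)
    ((sum_div_marg_mul_le hp (fun ω => (A ω, B ω)) (f := fun c => marg p A c.1 * marg p B c.2)
      (fun c => mul_nonneg (marg_nonneg hp.nonneg _ _) (marg_nonneg hp.nonneg _ _))).trans (by
        rw [Fintype.sum_prod_type]
        simp only
        simp_rw [← Finset.mul_sum, (hp.marg B).sum_eq, mul_one, (hp.marg A).sum_eq]; rfl))
  rw [ent_eq, ent_eq, ent_eq]
  have : ∑ ω, p ω * Real.log (marg p A (A ω) * marg p B (B ω) /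
      marg p (fun ω => (A ω, B ω)) (A ω, B ω)) = ∑ ω, p ω * Real.log (marg p A (A ω))
      + ∑ ω, p ω * Real.log (marg p B (B ω))
      - ∑ ω, p ω * Real.log (marg p (fun ω => (A ω, B ω)) (A ω, B ω)) := by
    rw [← Finset.sum_add_distrib, ← Finset.sum_sub_distrib]
    refine Finset.sum_congr rfl fun ω _ => ?_
    rcases (hp.nonneg ω).eq_or_lt with h0 | h0
    · simp [← h0]
    have h1 := marg_pos hp.nonneg A h0
    have h2 := marg_pos hp.nonneg B h0
    have h3 := marg_pos hp.nonneg (fun ω => (A ω, B ω)) h0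
    rw [Real.log_div (by positivity) h3.ne', Real.log_mul h1.ne' h2.ne']
    ring
  linarith

lemma ent_comp_equiv (p : Ω → ℝ) (A : Ω → α) (e : α ≃ β) :
    ent p (fun ω => e (A ω)) = ent p A := by
  classical
  rw [ent, ent, ← e.sum_comp]
  simp [marg]

lemma ent_swap (p : Ω → ℝ) (A : Ω → α) (B : Ω → β) :
    ent p (fun ω => (B ω, A ω)) = ent p fun ω => (A ω, B ω) :=
  ent_comp_equiv p (fun ω => (A ω, B ω)) (Equiv.prodComm α β)

end Weights

/-! ### Translation between `PMF` and real weights -/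

section PMF

variable {Ω α β : Type*} [Fintype Ω] [Fintype α] [Fintype β]

/-- The point masses of a distribution as real numbers. -/
def wt {Ω : Type*} (p : PMF Ω) (ω : Ω) : ℝ := (p ω).toReal

lemma isWeight_wt (p : PMF Ω) : IsWeight (wt p) := by
  refine ⟨fun _ => ENNReal.toReal_nonneg, ?_⟩
  simp_rw [wt]
  rw [← ENNReal.toReal_sum fun a _ => p.apply_ne_top a, ← tsum_fintype (L := .unconditional _),
    p.tsum_coe]
  rfl

/-- The distribution with given real point masses. -/
def ofWeight (p : Ω → ℝ) (hp : IsWeight p) : PMF Ω :=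
  PMF.ofFintype (fun ω => ENNReal.ofReal (p ω)) (by
    rw [← ENNReal.ofReal_sum_of_nonneg fun ω _ => hp.nonneg ω, hp.sum_eq, ENNReal.ofReal_one])

lemma wt_ofWeight (p : Ω → ℝ) (hp : IsWeight p) : wt (ofWeight p hp) = p := by
  ext ω
  simp [wt, ofWeight, hp.nonneg ω]

lemma wt_map (p : PMF Ω) (A : Ω → α) : wt (p.map A) = marg (wt p) A := by
  classical
  ext a
  rw [wt, PMF.map_apply, tsum_fintype, ENNReal.toReal_sum]
  · refine Finset.sum_congr rfl fun ω _ => ?_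
    by_cases h : A ω = a
    · simp [h, wt]
    · simp [h, Ne.symm h]
  · intro ω _
    split_ifs
    exacts [p.apply_ne_top ω, ENNReal.zero_ne_top]

lemma wt_bind (p : PMF Ω) (f : Ω → PMF α) (a : α) :
    wt (p.bind f) a = ∑ ω, wt p ω * wt (f ω) a := by
  rw [wt, PMF.bind_apply, tsum_fintype, ENNReal.toReal_sum]
  · simp [wt]
  · exact fun ω _ => ENNReal.mul_ne_top (p.apply_ne_top ω) ((f ω).apply_ne_top a)

lemma wt_bind_map (p : PMF Ω) (f : Ω → PMF α) (ω : Ω) (a : α) :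
    wt (p.bind fun ω => (f ω).map fun a => (a, ω)) (a, ω) = wt p ω * wt (f ω) a := by
  classical
  rw [wt_bind, Finset.sum_eq_single ω]
  · rw [wt_map]; simp [marg]
  · intro ω' _ h
    rw [wt_map]; simp [marg, h]
  · simp

lemma rvEntropy_eq (p : PMF Ω) (A : Ω → α) : rvEntropy p A = ent (wt p) A := by
  rw [rvEntropy, shannonEntropy, ent, ← wt_map]; rfl

lemma mutualInfo_eq (p : PMF Ω) (A : Ω → α) (B : Ω → β) :
    mutualInfo p A B = ent (wt p) A + ent (wt p) B - ent (wt p) fun ω => (A ω, B ω) := by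
  simp [mutualInfo, rvEntropy_eq]

open Classical in
lemma prob_eq (p : PMF Ω) (E : Set Ω) : prob p E = ∑ ω, if ω ∈ E then wt p ω else 0 := by
  rw [prob, PMF.toOuterMeasure_apply, tsum_fintype, ENNReal.toReal_sum]
  · refine Finset.sum_congr rfl fun ω _ => ?_
    by_cases h : ω ∈ E <;> simp [h, wt]
  · intro ω _
    by_cases h : ω ∈ E <;> simp [h, p.apply_ne_top]

lemma wt_iid (p : PMF α) (n : ℕ) (z : Fin n → α) : wt (iid p n) z = ∏ i, wt p (z i) := by
  simp [wt, iid, ENNReal.toReal_prod]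

end PMF

/-! ### Carathéodory reduction with one vector saved by connectedness -/

section ConicReduction

variable {T κ : Type*} [Fintype T] [Fintype κ]

/-- A family of at least `|T| + |κ|` nonnegative vectors can be changed such that one of them
vanishes, without changing the sum of the vectors and the sum of their values under a continuous
positively homogeneous function with values in `κ → ℝ`. -/
lemma exists_family_with_zero {ι : Type*} [Fintype ι] {G : (T → ℝ) → κ → ℝ} (hG : Continuous G)
    (hom : ∀ (c : ℝ) (v : T → ℝ), 0 ≤ c → G (c • v) = c • G v) {v : ι → T → ℝ}
    (hv : ∀ i, 0 ≤ v i) (h2 : 2 ≤ Fintype.card ι)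
    (hcard : Fintype.card T + Fintype.card κ ≤ Fintype.card ι) :
    ∃ v' : ι → T → ℝ, (∀ i, 0 ≤ v' i) ∧ (∃ j, v' j = 0) ∧ ∑ i, v' i = ∑ i, v i ∧
      ∑ i, G (v' i) = ∑ i, G (v i) := by
  classical
  set L : (T → ℝ) → (T → ℝ) × (κ → ℝ) := fun v => (v, G v) with hL
  have L_hom : ∀ (c : ℝ) (v : T → ℝ), 0 ≤ c → L (c • v) = c • L v := fun c v hc => by
    simp [hL, hom c v hc]
  suffices h : ∃ v' : ι → T → ℝ, (∀ i, 0 ≤ v' i) ∧ (∃ j, v' j = 0) ∧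
      ∑ i, L (v' i) = ∑ i, L (v i) by
    obtain ⟨v', h1, h2, h3⟩ := h
    refine ⟨v', h1, h2, ?_, ?_⟩
    · simpa [hL, Prod.fst_sum] using congrArg Prod.fst h3
    · simpa [hL, Prod.snd_sum] using congrArg Prod.snd h3
  have hfin : Module.finrank ℝ ((T → ℝ) × (κ → ℝ)) = Fintype.card T + Fintype.card κ := by simp
  by_cases hli : LinearIndependent ℝ fun i => L (v i)
  · have hc : Fintype.card ι = Module.finrank ℝ ((T → ℝ) × (κ → ℝ)) :=
      le_antisymm hli.fintype_card_le_finrank (hfin ▸ hcard)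
    have hne : Nonempty ι := Fintype.card_pos_iff.1 (by omega)
    let B := basisOfLinearIndependentOfCardEqFinrank hli hc
    have hB : ∀ i, B i = L (v i) := fun i => by simp [B]
    obtain ⟨i₀, i₁, h01⟩ := Fintype.exists_pair_of_one_lt_card (by omega : 1 < Fintype.card ι)
    -- No linear relation is available, so connectedness is used: along this segment the coordinates
    -- of `L (x s)` in the basis move continuously from the unit vector at `i₀` to the one at `i₁`.
    let x : ℝ → T → ℝ := fun s => (1 - s) • v i₀ + s • v i₁
    have hx : Continuous x := by fun_prop
    let b : ℝ → ι → ℝ := fun s => B.equivFun (L (x s))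
    have hb : Continuous b :=
      (LinearMap.continuous_of_finiteDimensional B.equivFun.toLinearMap).comp
        (hx.prodMk (hG.comp hx))
    have hbj : ∀ j, Continuous fun s => b s j := fun j => (continuous_apply j).comp hb
    have hrep : ∀ s, ∑ j, b s j • L (v j) = L (x s) := fun s => by
      have := B.sum_equivFun (L (x s))
      simpa [hB, b] using this
    have hS : (Finset.univ.erase i₀).Nonempty := ⟨i₁, by simp [h01.symm]⟩
    -- At a zero of `φ` the coordinate at `i₀` ties with the largest of the others, attained at some
    -- `k`.
    let φ : ℝ → ℝ := fun s => (Finset.univ.erase i₀).sup' hS (fun j => b s j) - b s i₀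
    have hφ : Continuous φ :=
      (Continuous.finset_sup'_apply hS fun j _ => hbj j).sub (hbj i₀)
    have hb0 : ∀ j, b 0 j = if j = i₀ then 1 else 0 := fun j => by
      have : B.equivFun (B i₀) j = if j = i₀ then 1 else 0 := by
        simp [eq_comm]
      simpa [b, x, hB] using this
    have hb1 : ∀ j, b 1 j = if j = i₁ then 1 else 0 := fun j => by
      have : B.equivFun (B i₁) j = if j = i₁ then 1 else 0 := by
        simp [eq_comm]
      simpa [b, x, hB] using this
    have hφ0 : φ 0 ≤ 0 := by
      have : (Finset.univ.erase i₀).sup' hS (fun j => b 0 j) ≤ 0 :=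
        Finset.sup'_le _ _ fun j hj => by simp [hb0, Finset.ne_of_mem_erase hj]
      simp only [φ, hb0 i₀, if_true]
      linarith
    have hφ1 : 0 ≤ φ 1 := by
      have := Finset.le_sup' (fun j => b 1 j) (show i₁ ∈ Finset.univ.erase i₀ by simp [h01.symm])
      simp only [hb1 i₁, if_true] at this
      simp only [φ, hb1 i₀, if_neg h01]
      linarith
    obtain ⟨s, hs, hs0⟩ := intermediate_value_Icc zero_le_one hφ.continuousOn ⟨hφ0, hφ1⟩
    obtain ⟨k, hk, hks⟩ := Finset.exists_mem_eq_sup' hS (fun j => b s j)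
    have hki : k ≠ i₀ := Finset.ne_of_mem_erase hk
    have htie : b s k = b s i₀ := by
      have : φ s = 0 := hs0
      simp only [φ, hks] at this
      linarith
    have hmax : ∀ j, b s j ≤ b s k := fun j => by
      by_cases hj : j = i₀
      · rw [hj, htie]
      · rw [← hks]; exact Finset.le_sup' (fun j => b s j) (by simp [hj])
    have hx0 : 0 ≤ x s := add_nonneg (smul_nonneg (by linarith [hs.2]) (hv _))
      (smul_nonneg hs.1 (hv _))
    -- If the largest coordinate were nonpositive, `x s ≥ 0` would be a nonpositive combination of
    -- nonnegative vectors, hence zero. But `v i₀` and `v i₁` are nonzero by independence, and `s`,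
    -- `1 - s` do not both vanish.
    have hpos : 0 < b s k := by
      by_contra hneg
      have hle : ∀ j, b s j ≤ 0 := fun j => (hmax j).trans (not_lt.1 hneg)
      have hsum : ∑ j, b s j • v j = x s := by
        simpa [hL, Prod.fst_sum] using congrArg Prod.fst (hrep s)
      have hxz : x s = 0 := le_antisymm (hsum ▸ Finset.sum_nonpos fun j _ => by
        intro t
        simpa using mul_nonpos_of_nonpos_of_nonneg (hle j) (hv j t)) hx0
      have hz : ∀ i, v i ≠ 0 := fun i h => hli.ne_zero i (by
        have := L_hom 0 0 le_rfl
        simpa [h] using this)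
      have e1 : (1 - s) • v i₀ = 0 ∧ s • v i₁ = 0 :=
        (add_eq_zero_iff_of_nonneg (smul_nonneg (by linarith [hs.2]) (hv _))
          (smul_nonneg hs.1 (hv _))).1 hxz
      have e2 := (smul_eq_zero.1 e1.1).resolve_right (hz _)
      have e3 := (smul_eq_zero.1 e1.2).resolve_right (hz _)
      linarith
    set c := (b s k)⁻¹ with hcdef
    have hc0 : 0 < c := inv_pos.2 hpos
    have hck : c * b s k = 1 := inv_mul_cancel₀ hpos.ne'
    have hw : ∀ j, 0 ≤ 1 - c * b s j := fun j => by
      have := mul_le_mul_of_nonneg_left (hmax j) hc0.le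
      linarith
    -- Removing the multiple `c • L (x s)` from the sum annihilates the vectors at `i₀` and at `k`
    -- together, because of the tie. The slot `i₀` takes `c • x s` back, and the slot `k` stays
    -- empty.
    refine ⟨fun j => if j = i₀ then c • x s else (1 - c * b s j) • v j, fun j => ?_, ⟨k, ?_⟩, ?_⟩
    · dsimp only
      split_ifs
      exacts [smul_nonneg hc0.le hx0, smul_nonneg (hw j) (hv j)]
    · simp [hki, hck]
    · have h1 : ∀ j, L (if j = i₀ then c • x s else (1 - c * b s j) • v j)
          = (if j = i₀ then c • L (x s) else 0) + (1 - c * b s j) • L (v j) := fun j => by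
        by_cases hj : j = i₀
        · rw [if_pos hj, if_pos hj, L_hom _ _ hc0.le, hj, ← htie, hck]; simp
        · rw [if_neg hj, if_neg hj, L_hom _ _ (hw j), zero_add]
      simp_rw [h1]
      rw [Finset.sum_add_distrib, Finset.sum_ite_eq' Finset.univ i₀ fun _ => c • L (x s),
        if_pos (Finset.mem_univ _), ← hrep s, Finset.smul_sum, ← Finset.sum_add_distrib]
      refine Finset.sum_congr rfl fun j _ => ?_
      rw [smul_smul, ← add_smul]
      simp
  · rw [Fintype.not_linearIndependent_iff] at hli
    obtain ⟨g, hg, i, hi⟩ := hli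
    wlog hpos : 0 < g i generalizing g
    · exact this (-g) (by simpa using hg) (by simpa using hi)
        (by have := lt_of_le_of_ne (not_lt.1 hpos) hi; simpa using this)
    have hne : Nonempty ι := ⟨i⟩
    obtain ⟨j, hj⟩ := Finite.exists_max g
    have hgj : 0 < g j := hpos.trans_le (hj i)
    have hw : ∀ i, 0 ≤ 1 - (g j)⁻¹ * g i := fun i => by
      have := mul_le_mul_of_nonneg_left (hj i) (inv_pos.2 hgj).le
      rw [inv_mul_cancel₀ hgj.ne'] at this
      linarith
    -- Subtracting the relation, scaled by its largest coefficient, keeps all weights nonnegative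
    -- and kills the vector at `j`.
    refine ⟨fun i => (1 - (g j)⁻¹ * g i) • v i, fun i => smul_nonneg (hw i) (hv i), ⟨j, ?_⟩, ?_⟩
    · simp [inv_mul_cancel₀ hgj.ne']
    · have h1 : ∀ i, L ((1 - (g j)⁻¹ * g i) • v i) = L (v i) - (g j)⁻¹ • g i • L (v i) :=
        fun i => by rw [L_hom _ _ (hw i), sub_smul, one_smul, smul_smul]
      simp_rw [h1]
      rw [Finset.sum_sub_distrib, ← Finset.smul_sum, hg]
      simp

/-- Fenchel-Eggleston-Carathéodory theorem for the cone over the graph of a continuous positively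
homogeneous function on the nonnegative orthant. -/
lemma exists_small_family {G : (T → ℝ) → κ → ℝ} (hG : Continuous G)
    (hom : ∀ (c : ℝ) (v : T → ℝ), 0 ≤ c → G (c • v) = c • G v)
    {k : ℕ} (hk : 1 ≤ k) (hcard : Fintype.card T + Fintype.card κ ≤ k + 1) (m : ℕ)
    (v : Fin m → T → ℝ) (hv : ∀ i, 0 ≤ v i) :
    ∃ m' ≤ k, ∃ v' : Fin m' → T → ℝ, (∀ i, 0 ≤ v' i) ∧ ∑ i, v' i = ∑ i, v i ∧
      ∑ i, G (v' i) = ∑ i, G (v i) := by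
  induction m with
  | zero => exact ⟨0, Nat.zero_le _, v, hv, rfl, rfl⟩
  | succ m ih =>
    by_cases hm : m + 1 ≤ k
    · exact ⟨m + 1, hm, v, hv, rfl, rfl⟩
    obtain ⟨v', h1, ⟨j, hj⟩, h3, h4⟩ := exists_family_with_zero hG hom hv
      (by simp; omega) (by simp; omega)
    have h0 : G 0 = 0 := by simpa using hom 0 0 le_rfl
    obtain ⟨m', hm', w, g1, g2, g3⟩ := ih (fun i => v' (j.succAbove i)) fun i => h1 _
    refine ⟨m', hm', w, g1, ?_, ?_⟩
    · rw [g2, ← h3, Fin.sum_univ_succAbove _ j, hj, zero_add]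
    · rw [g3, ← h4, Fin.sum_univ_succAbove _ j, hj, h0, zero_add]

end ConicReduction

/-! ### Homogeneous form of conditional entropy -/

section CondEntropy

variable {T α Z : Type*} [Fintype T] [Fintype α] [Fintype Z]

/-- `∑ a, η (y a) - η (∑ a, y a)` with `η t = - t log t`: the entropy of the normalization of `y`,
times the mass of `y`. -/
def massEntropy (y : α → ℝ) : ℝ := ∑ a, Real.negMulLog (y a) - Real.negMulLog (∑ a, y a)

lemma continuous_massEntropy : Continuous (massEntropy : (α → ℝ) → ℝ) := by
  unfold massEntropy
  fun_prop

/-- The extra terms `η c` times the masses, from `η (c t) = t η c + c η t`, cancel against the term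
for the total mass. -/
lemma massEntropy_smul (c : ℝ) (y : α → ℝ) : massEntropy (c • y) = c * massEntropy y := by
  simp only [massEntropy, Pi.smul_apply, smul_eq_mul, ← Finset.mul_sum, Real.negMulLog_mul,
    Finset.sum_add_distrib, ← Finset.sum_mul]
  ring

/-- The measure on `α` obtained from a measure `v` on `T` through the conditional law of `A`
given `B`. -/
def pushCond (p : Z → ℝ) (B : Z → T) (A : Z → α) (v : T → ℝ) (a : α) : ℝ :=
  ∑ t, v t * (marg p (fun z => (A z, B z)) (a, t) / marg p B t)

lemma continuous_pushCond (p : Z → ℝ) (B : Z → T) (A : Z → α) : Continuous (pushCond p B A) := by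
  unfold pushCond
  fun_prop

lemma pushCond_smul (p : Z → ℝ) (B : Z → T) (A : Z → α) (c : ℝ) (v : T → ℝ) :
    pushCond p B A (c • v) = c • pushCond p B A v := by
  ext a
  simp [pushCond, Finset.mul_sum, mul_assoc]

end CondEntropy

/-! ### Auxiliary channels and the vectors that represent them -/

section Channel

variable {U T Z α : Type*} [Fintype U] [Fintype T] [Fintype Z] [Fintype α]

/-- Joint weight of `(U, Z)`, where `U` is the output of the channel `q` with input `B Z`. -/
def joint (p : Z → ℝ) (B : Z → T) (q : T → U → ℝ) (ω : U × Z) : ℝ := p ω.2 * q (B ω.2) ω.1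

lemma isWeight_joint {p : Z → ℝ} (hp : IsWeight p) (B : Z → T) {q : T → U → ℝ}
    (hq : ∀ t, IsWeight (q t)) : IsWeight (joint p B q) := by
  refine ⟨fun ω => mul_nonneg (hp.nonneg _) ((hq _).nonneg _), ?_⟩
  rw [Fintype.sum_prod_type_right]
  simp only [joint]
  simp_rw [← Finset.mul_sum, (hq _).sum_eq, mul_one, hp.sum_eq]

lemma marg_joint_snd {p : Z → ℝ} {B : Z → T} {q : T → U → ℝ} (hq : ∀ t, IsWeight (q t))
    (A : Z → α) (a : α) : marg (joint p B q) (fun ω => A ω.2) a = marg p A a := by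
  classical
  rw [marg, Fintype.sum_prod_type_right, marg]
  refine Finset.sum_congr rfl fun z _ => ?_
  by_cases h : A z = a
  · simp [h, joint, ← Finset.mul_sum, (hq _).sum_eq]
  · simp [h]

lemma marg_joint_pair {p : Z → ℝ} (hp : ∀ z, 0 ≤ p z) (B : Z → T) (q : T → U → ℝ) (A : Z → α)
    (u : U) (a : α) :
    marg (joint p B q) (fun ω => (ω.1, A ω.2)) (u, a) =
      pushCond p B A (fun t => marg p B t * q t u) a := by
  classical
  have h1 : ∀ t, marg p B t * q t u * (marg p (fun z => (A z, B z)) (a, t) / marg p B t)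
      = marg p (fun z => (A z, B z)) (a, t) * q t u := fun t => by
    -- If `t` has no mass, the quotient is zero by convention, and so is the joint mass.
    rcases (marg_nonneg hp B t).eq_or_lt with h | h
    · have := marg_pair_le_right hp A B a t
      have h2 := marg_nonneg hp (fun z => (A z, B z)) (a, t)
      rw [← h] at this ⊢
      simp [le_antisymm this h2]
    · field_simp
  rw [pushCond, Finset.sum_congr rfl fun t _ => h1 t]
  have h2 := sum_marg_mul p (fun z => (A z, B z)) fun c => if c.1 = a then q c.2 u else 0
  rw [Fintype.sum_prod_type_right] at h2
  have h3 : ∀ t, ∑ x, marg p (fun z => (A z, B z)) (x, t) * (if x = a then q t u else 0)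
      = marg p (fun z => (A z, B z)) (a, t) * q t u := fun t => by simp
  simp only [h3] at h2
  rw [h2, marg, Fintype.sum_prod_type, Finset.sum_eq_single u]
  · refine Finset.sum_congr rfl fun z _ => ?_
    by_cases h : A z = a <;> simp [h, joint]
  · intro u' _ hu
    simp [hu]
  · simp

/-- This is I(U;A) = H(A) - H(A|U). Since H(A) does not depend on the channel, keeping the sum over
`u` keeps the information. -/
lemma info_joint_eq {p : Z → ℝ} (hp : IsWeight p) (B : Z → T) {q : T → U → ℝ}
    (hq : ∀ t, IsWeight (q t)) (A : Z → α) :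
    ent (joint p B q) (fun ω => ω.1) + ent (joint p B q) (fun ω => A ω.2)
      - ent (joint p B q) (fun ω => (ω.1, A ω.2))
      = ent p A - ∑ u, massEntropy (pushCond p B A fun t => marg p B t * q t u) := by
  have h1 : ∀ u, massEntropy (pushCond p B A fun t => marg p B t * q t u)
      = ∑ a, Real.negMulLog (marg (joint p B q) (fun ω => (ω.1, A ω.2)) (u, a))
        - Real.negMulLog (marg (joint p B q) (fun ω => ω.1) u) := fun u => by
    have : pushCond p B A (fun t => marg p B t * q t u)
        = fun a => marg (joint p B q) (fun ω => (ω.1, A ω.2)) (u, a) :=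
      funext fun a => (marg_joint_pair hp.nonneg B q A u a).symm
    rw [massEntropy, this, sum_marg_pair_right (joint p B q) (fun ω => ω.1) fun ω => A ω.2]
  simp_rw [h1]
  rw [Finset.sum_sub_distrib]
  have h2 : ent (joint p B q) (fun ω => A ω.2) = ent p A := by
    simp_rw [ent, marg_joint_snd hq]
  rw [h2]
  simp only [ent, Fintype.sum_prod_type]
  ring

/-- A finite family of nonnegative vectors whose sum is the law of `B` comes from a channel. -/
lemma exists_channel_of_sum_eq {m : ℕ} {p : Z → ℝ} (hp : IsWeight p) (B : Z → T)
    {v : Fin m → T → ℝ} (hv : ∀ i, 0 ≤ v i) (hsum : ∑ i, v i = marg p B) :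
    ∃ q : T → PMF (Fin m), ∀ i, (fun t => marg p B t * wt (q t) i) = v i := by
  classical
  have hs : ∀ t, ∑ i, v i t = marg p B t := fun t => by
    rw [← hsum, Finset.sum_apply]
  have hm : Nonempty (Fin m) := by
    by_contra h
    rw [not_nonempty_iff] at h
    have := (hp.marg B).sum_eq
    simp [← hs] at this
  have key : ∀ t, ∃ q : PMF (Fin m), ∀ i, marg p B t * wt q i = v i t := fun t => by
    rcases (marg_nonneg hp.nonneg B t).eq_or_lt with h | h
    -- Where `t` has no mass all `v i t` vanish, so any distribution serves.
    · refine ⟨PMF.pure hm.some, fun i => ?_⟩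
      rw [← h, zero_mul]
      have h2 : ∑ i, v i t = 0 := by rw [hs, ← h]
      exact ((Finset.sum_eq_zero_iff_of_nonneg fun i _ => hv i t).1 h2 i (Finset.mem_univ i)).symm
    · have hw : IsWeight fun i => v i t / marg p B t :=
        ⟨fun i => div_nonneg (hv i t) h.le, by rw [← Finset.sum_div, hs, div_self h.ne']⟩
      refine ⟨ofWeight _ hw, fun i => ?_⟩
      rw [wt_ofWeight, mul_div_cancel₀ _ h.ne']
  choose q hq using key
  exact ⟨q, fun i => funext fun t => hq t i⟩

end Channel

/-! ### Alphabet bounds for the four regions -/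

section Regions

variable {X Xt Y : Type*} [Fintype X] [Fintype Xt] [Fintype Y]

lemma wt_auxLaw (PX : PMF X) (BC : X → PMF (Xt × Y)) {m : ℕ} (Q : Xt → PMF (Fin m)) :
    wt (auxLaw PX BC Q)
      = joint (wt (sourceLaw PX BC)) (fun z => z.2.1) fun t => wt (Q t) := by
  ext ⟨u, z⟩
  exact wt_bind_map (sourceLaw PX BC) (fun z => Q z.2.1) z u

/-- The contribution to `H(A | U)` of a value of `U` whose joint mass with `X̃` is `v`. -/
def condContribution {α : Type*} [Fintype α] (PX : PMF X) (BC : X → PMF (Xt × Y))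
    (A : X × Xt × Y → α) (v : Xt → ℝ) : ℝ :=
  massEntropy (pushCond (wt (sourceLaw PX BC)) (fun z => z.2.1) A v)

/-- Joint mass of `U = u` and `X̃`. -/
def jointMass (PX : PMF X) (BC : X → PMF (Xt × Y)) {m : ℕ} (Q : Xt → PMF (Fin m)) (u : Fin m)
    (t : Xt) : ℝ :=
  marg (wt (sourceLaw PX BC)) (fun z => z.2.1) t * wt (Q t) u

lemma mutualInfo_auxLaw {α : Type*} [Fintype α] (PX : PMF X) (BC : X → PMF (Xt × Y)) {m : ℕ}
    (Q : Xt → PMF (Fin m)) (A : X × Xt × Y → α) :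
    mutualInfo (auxLaw PX BC Q) (fun ω => ω.1) (fun ω => A ω.2)
      = ent (wt (sourceLaw PX BC)) A - ∑ u, condContribution PX BC A (jointMass PX BC Q u) := by
  rw [mutualInfo_eq, wt_auxLaw, info_joint_eq (isWeight_wt _) _ fun t => isWeight_wt _]
  rfl

lemma continuous_condContribution {α : Type*} [Fintype α] (PX : PMF X) (BC : X → PMF (Xt × Y))
    (A : X × Xt × Y → α) : Continuous (condContribution PX BC A) :=
  continuous_massEntropy.comp (continuous_pushCond _ _ _)

lemma condContribution_smul {α : Type*} [Fintype α] (PX : PMF X) (BC : X → PMF (Xt × Y))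
    (A : X × Xt × Y → α) (c : ℝ) (v : Xt → ℝ) :
    condContribution PX BC A (c • v) = c * condContribution PX BC A v := by
  rw [condContribution, pushCond_smul, massEntropy_smul, condContribution]

/-- Sums over the values of `U` of continuous homogeneous functions of the joint mass with `X̃` can
be preserved with a small alphabet of `U`. -/
lemma exists_small_alphabet {κ : Type*} [Fintype κ] (PX : PMF X) (BC : X → PMF (Xt × Y))
    {φ : κ → (Xt → ℝ) → ℝ} (hφ : ∀ j, Continuous (φ j))
    (hom : ∀ j (c : ℝ) (v : Xt → ℝ), φ j (c • v) = c * φ j v) {k : ℕ} (hk : 1 ≤ k)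
    (hcard : Fintype.card Xt + Fintype.card κ ≤ k + 1) {m : ℕ} (Q : Xt → PMF (Fin m)) :
    ∃ m' ≤ k, ∃ Q' : Xt → PMF (Fin m'), ∀ j,
      ∑ u, φ j (jointMass PX BC Q' u) = ∑ u, φ j (jointMass PX BC Q u) := by
  have hp := isWeight_wt (sourceLaw PX BC)
  obtain ⟨m', hm', v', h1, h2, h3⟩ := exists_small_family
    (G := fun v j => φ j v) (continuous_pi hφ) (fun c v _ => funext fun j => hom j c v) hk hcard m
    (jointMass PX BC Q)
    fun u t => mul_nonneg (marg_nonneg hp.nonneg _ t) ((isWeight_wt _).nonneg _)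
  have hsum : ∑ u, jointMass PX BC Q u = marg (wt (sourceLaw PX BC)) fun z => z.2.1 := by
    ext t
    simp only [Finset.sum_apply, jointMass]
    rw [← Finset.mul_sum, (isWeight_wt _).sum_eq, mul_one]
  obtain ⟨Q', hQ'⟩ := exists_channel_of_sum_eq hp (fun z => z.2.1) h1 (h2.trans hsum)
  refine ⟨m', hm', Q', fun j => ?_⟩
  have h4 := congrFun h3 j
  simp only [Finset.sum_apply] at h4
  rw [← h4]
  exact Finset.sum_congr rfl fun u _ => by rw [← hQ' u]; rfl

/-- The law of X̃ and three conditional entropies take |X̃| + 3 dimensions. One is saved in the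
reduction. -/
lemma exists_alphabet_preserving_all (PX : PMF X) (BC : X → PMF (Xt × Y)) {m : ℕ}
    (Q : Xt → PMF (Fin m)) :
    ∃ m' ≤ Fintype.card Xt + 2, ∃ Q' : Xt → PMF (Fin m'),
      infoUX PX BC Q' = infoUX PX BC Q ∧ infoUY PX BC Q' = infoUY PX BC Q ∧
        infoUXt PX BC Q' = infoUXt PX BC Q := by
  obtain ⟨m', hm', Q', h⟩ := exists_small_alphabet PX BC
    (φ := ![condContribution PX BC fun z => z.1, condContribution PX BC fun z => z.2.2,
      condContribution PX BC fun z => z.2.1])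
    (fun j => by fin_cases j <;> exact continuous_condContribution _ _ _)
    (fun j => by fin_cases j <;> exact condContribution_smul _ _ _)
    (k := Fintype.card Xt + 2) (by omega) (by simp) Q
  have h0 := h 0
  have h1 := h 1
  have h2 := h 2
  simp only [Matrix.cons_val] at h0 h1 h2
  refine ⟨m', hm', Q', ?_, ?_, ?_⟩
  · rw [infoUX, infoUX, mutualInfo_auxLaw PX BC _ fun z => z.1,
      mutualInfo_auxLaw PX BC _ fun z => z.1, h0]
  · rw [infoUY, infoUY, mutualInfo_auxLaw PX BC _ fun z => z.2.2,
      mutualInfo_auxLaw PX BC _ fun z => z.2.2, h1]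
  · rw [infoUXt, infoUXt, mutualInfo_auxLaw PX BC _ fun z => z.2.1,
      mutualInfo_auxLaw PX BC _ fun z => z.2.1, h2]

lemma exists_alphabet_preserving_key_storage (PX : PMF X) (BC : X → PMF (Xt × Y)) {m : ℕ}
    (Q : Xt → PMF (Fin m)) :
    ∃ m' ≤ Fintype.card Xt + 1, ∃ Q' : Xt → PMF (Fin m'),
      infoUY PX BC Q' = infoUY PX BC Q ∧ infoUXt PX BC Q' = infoUXt PX BC Q := by
  obtain ⟨m', hm', Q', h⟩ := exists_small_alphabet PX BC
    (φ := ![condContribution PX BC fun z => z.2.2, condContribution PX BC fun z => z.2.1])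
    (fun j => by fin_cases j <;> exact continuous_condContribution _ _ _)
    (fun j => by fin_cases j <;> exact condContribution_smul _ _ _)
    (k := Fintype.card Xt + 1) (by omega) (by simp) Q
  have h0 := h 0
  have h1 := h 1
  simp only [Matrix.cons_val] at h0 h1
  refine ⟨m', hm', Q', ?_, ?_⟩
  · rw [infoUY, infoUY, mutualInfo_auxLaw PX BC _ fun z => z.2.2,
      mutualInfo_auxLaw PX BC _ fun z => z.2.2, h0]
  · rw [infoUXt, infoUXt, mutualInfo_auxLaw PX BC _ fun z => z.2.1,
      mutualInfo_auxLaw PX BC _ fun z => z.2.1, h1]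

/-- A union over channels, restricted by a property of the three informations, does not change if
the alphabet of `U` is bounded, provided that every channel can be replaced by one with a small
alphabet and the same rate set. -/
lemma union_channels_eq {C : ∀ {m : ℕ}, (Xt → PMF (Fin m)) → Prop}
    {R : ∀ {m : ℕ}, (Xt → PMF (Fin m)) → Set (ℝ × ℝ × ℝ)} (k : ℕ)
    (h : ∀ (m : ℕ) (Q : Xt → PMF (Fin m)), C Q → ∃ m' ≤ k, ∃ Q' : Xt → PMF (Fin m'),
      C Q' ∧ R Q' = R Q) :
    (⋃ (m : ℕ) (_ : (m : ℕ∞) ≤ ⊤) (Q : Xt → PMF (Fin m)) (_ : C Q), R Q)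
      = ⋃ (m : ℕ) (_ : (m : ℕ∞) ≤ k) (Q : Xt → PMF (Fin m)) (_ : C Q), R Q := by
  ext r
  simp only [Set.mem_iUnion, exists_prop]
  constructor
  · rintro ⟨m, -, Q, hC, hr⟩
    obtain ⟨m', hm', Q', hC', hR⟩ := h m Q hC
    exact ⟨m', by exact_mod_cast hm', Q', hC', hR ▸ hr⟩
  · rintro ⟨m, -, Q, hC, hr⟩
    exact ⟨m, le_top, Q, hC, hr⟩

variable (PX : PMF X) (BC : X → PMF (Xt × Y))

lemma region1_eq : region1 PX BC ⊤ = region1 PX BC (Fintype.card Xt + 2) := by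
  refine union_channels_eq (Fintype.card Xt + 2) fun m Q hC => ?_
  obtain ⟨m', hm', Q', h1, h2, h3⟩ := exists_alphabet_preserving_all PX BC Q
  exact ⟨m', hm', Q', by rwa [h1, h2], by simp only [ratesGS, h1, h2, h3]⟩

lemma region2_eq : region2 PX BC ⊤ = region2 PX BC (Fintype.card Xt + 2) := by
  refine union_channels_eq (Fintype.card Xt + 2) fun m Q hC => ?_
  obtain ⟨m', hm', Q', h1, h2, h3⟩ := exists_alphabet_preserving_all PX BC Q
  exact ⟨m', hm', Q', by rwa [h1, h2], by simp only [ratesGS, h1, h2, h3]⟩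

lemma region3_eq : region3 PX BC ⊤ = region3 PX BC (Fintype.card Xt + 2) := by
  refine union_channels_eq (Fintype.card Xt + 2) fun m Q hC => ?_
  obtain ⟨m', hm', Q', h1, h2, h3⟩ := exists_alphabet_preserving_all PX BC Q
  exact ⟨m', hm', Q', by rwa [h1, h2], by simp only [ratesCS, h1, h2, h3]⟩

lemma region4_eq : region4 PX BC ⊤ = region4 PX BC (Fintype.card Xt + 2) := by
  refine union_channels_eq (Fintype.card Xt + 2) fun m Q hC => ?_
  obtain ⟨m', hm', Q', h1, h2, h3⟩ := exists_alphabet_preserving_all PX BC Q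
  exact ⟨m', hm', Q', by rwa [h1, h2], by simp only [ratesCS, h1, h2, h3]⟩

/-- Under the hypothesis the leakage bound is zero for the new channel as well, so I(U;X) need not
be preserved and one dimension drops out. -/
lemma region2_eq_of_le
    (h : ∀ (m : ℕ) (Q : Xt → PMF (Fin m)), infoUX PX BC Q ≤ infoUY PX BC Q) :
    region2 PX BC ⊤ = region2 PX BC (Fintype.card Xt + 1) := by
  refine union_channels_eq (Fintype.card Xt + 1) fun m Q hC => ?_
  obtain ⟨m', hm', Q', h2, h3⟩ := exists_alphabet_preserving_key_storage PX BC Q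
  have hC' : max 0 (infoUX PX BC Q' - infoUY PX BC Q') = 0 := max_eq_left (sub_nonpos.2 (h _ _))
  exact ⟨m', hm', Q', hC', by simp only [ratesGS, hC, hC']; simp only [h2, h3]⟩

lemma region4_eq_of_le
    (h : ∀ (m : ℕ) (Q : Xt → PMF (Fin m)), infoUX PX BC Q ≤ infoUY PX BC Q) :
    region4 PX BC ⊤ = region4 PX BC (Fintype.card Xt + 1) := by
  refine union_channels_eq (Fintype.card Xt + 1) fun m Q hC => ?_
  obtain ⟨m', hm', Q', h2, h3⟩ := exists_alphabet_preserving_key_storage PX BC Q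
  have hC' : max 0 (infoUX PX BC Q' - infoUY PX BC Q') = 0 := max_eq_left (sub_nonpos.2 (h _ _))
  exact ⟨m', hm', Q', hC', by simp only [ratesCS, hC, hC']; simp only [h2, h3]⟩

end Regions

/-! ### Universal hashing and the leftover hash lemma -/

section Hashing

variable {Ω σ ζ κ H : Type*} [Fintype Ω] [Fintype σ] [Fintype ζ] [Fintype κ] [Fintype H]

/-- The deficit `log |σ| - H(S | Z)` of the conditional entropy of `S` given `Z`. -/
def deficit (p : Ω → ℝ) (S : Ω → σ) (Z : Ω → ζ) : ℝ :=
  Real.log (Fintype.card σ) + ent p Z - ent p fun ω => (S ω, Z ω)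

lemma deficit_nonneg {p : Ω → ℝ} (hp : IsWeight p) (S : Ω → σ) (Z : Ω → ζ) :
    0 ≤ deficit p S Z := by
  have h1 := ent_pair_le hp S Z
  have h2 := ent_le_log_card hp S
  rw [deficit]; linarith

lemma deficit_eq {p : Ω → ℝ} (hp : IsWeight p) (S : Ω → σ) (Z : Ω → ζ) :
    deficit p S Z = ∑ ω, p ω * Real.log (Fintype.card σ *
      marg p (fun ω => (S ω, Z ω)) (S ω, Z ω) / marg p Z (Z ω)) := by
  have hne : Nonempty σ := hp.nonempty.map S
  have hc : (0 : ℝ) < Fintype.card σ := by exact_mod_cast Fintype.card_pos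
  rw [deficit, ent_eq, ent_eq, ← one_mul (Real.log (Fintype.card σ)), ← hp.sum_eq, Finset.sum_mul,
    sub_neg_eq_add, ← sub_eq_add_neg, ← Finset.sum_sub_distrib, ← Finset.sum_add_distrib]
  refine Finset.sum_congr rfl fun ω _ => ?_
  rcases (hp.nonneg ω).eq_or_lt with h | h
  · simp [← h]
  have h1 := marg_pos hp.nonneg Z h
  have h2 := marg_pos hp.nonneg (fun ω => (S ω, Z ω)) h
  rw [Real.log_div (by positivity) h1.ne', Real.log_mul hc.ne' h2.ne']
  ring

open Classical in
/-- A weighted family of functions for which distinct points collide with probability at most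
`1 / |σ|`. -/
def IsUniversal (μ : H → ℝ) (h : H → κ → σ) : Prop :=
  ∀ k k', k ≠ k' → ∑ i, (if h i k = h i k' then μ i else 0) ≤ 1 / Fintype.card σ

/-- Leftover hash lemma in terms of entropy. -/
lemma leftover_hash {μ : H → ℝ} (hμ : IsWeight μ) {h : H → κ → σ} (hu : IsUniversal μ h)
    {p : Ω → ℝ} (hp : IsWeight p) (K : Ω → κ) (Z : Ω → ζ) :
    ∑ i, μ i * deficit p (fun ω => h i (K ω)) Z ≤
      ∑ ω, p ω * Real.log (1 + Fintype.card σ *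
        (marg p (fun ω => (K ω, Z ω)) (K ω, Z ω) / marg p Z (Z ω))) := by
  classical
  have hne : Nonempty σ := by
    obtain ⟨i⟩ := hμ.nonempty
    obtain ⟨ω⟩ := hp.nonempty
    exact ⟨h i (K ω)⟩
  have hc : (0 : ℝ) < Fintype.card σ := by exact_mod_cast Fintype.card_pos
  simp_rw [deficit_eq hp, Finset.mul_sum]
  rw [Finset.sum_comm]
  refine Finset.sum_le_sum fun ω _ => ?_
  rcases (hp.nonneg ω).eq_or_lt with h0 | h0
  · simp [← h0]
  have hz := marg_pos hp.nonneg Z h0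
  have hkz := marg_nonneg hp.nonneg (fun ω => (K ω, Z ω)) (K ω, Z ω)
  have hswap : ∀ i, μ i * (p ω * Real.log (Fintype.card σ *
      marg p (fun ω => (h i (K ω), Z ω)) (h i (K ω), Z ω) / marg p Z (Z ω)))
      = p ω * (μ i * Real.log (Fintype.card σ *
      marg p (fun ω => (h i (K ω), Z ω)) (h i (K ω), Z ω) / marg p Z (Z ω))) := fun i => by ring
  simp_rw [hswap]
  rw [← Finset.mul_sum]
  refine mul_le_mul_of_nonneg_left ?_ h0.le
  -- Jensen's inequality over the hash functions: it remains to bound the average of the conditional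
  -- probability of the hash value.
  refine sum_mul_log_le hμ (fun i _ => ?_) (by positivity) ?_
  · have := marg_pos hp.nonneg (fun ω => (h i (K ω), Z ω)) h0
    positivity
  -- Outcomes with the same `K` always collide, the others with probability at most `1 / |σ|`.
  have hcoll : ∑ i, μ i * marg p (fun ω => (h i (K ω), Z ω)) (h i (K ω), Z ω) ≤
      marg p (fun ω => (K ω, Z ω)) (K ω, Z ω) + marg p Z (Z ω) * (1 / Fintype.card σ) := by
    simp only [marg, Finset.mul_sum, Finset.sum_mul]
    rw [Finset.sum_comm, ← Finset.sum_add_distrib]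
    refine Finset.sum_le_sum fun ω' _ => ?_
    by_cases hZ : Z ω' = Z ω
    · by_cases hK : K ω' = K ω
      · have h1 : 0 ≤ p ω' * (1 / (Fintype.card σ : ℝ)) := mul_nonneg (hp.nonneg _) (by positivity)
        simp only [hZ, hK, if_true, ← Finset.sum_mul, hμ.sum_eq]
        linarith
      · have h1 := mul_le_mul_of_nonneg_left (hu _ _ hK) (hp.nonneg ω')
        simp only [Prod.mk.injEq, hZ, hK, and_true, if_true, if_false, zero_add]
        refine le_trans (le_of_eq ?_) h1
        rw [Finset.mul_sum]
        refine Finset.sum_congr rfl fun i _ => ?_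
        split_ifs <;> ring
    · simp [hZ]
  have hrw : ∀ i, μ i * (Fintype.card σ * marg p (fun ω => (h i (K ω), Z ω)) (h i (K ω), Z ω) /
      marg p Z (Z ω)) = (μ i * marg p (fun ω => (h i (K ω), Z ω)) (h i (K ω), Z ω)) *
        (Fintype.card σ / marg p Z (Z ω)) := fun i => by ring
  simp_rw [hrw]
  rw [← Finset.sum_mul]
  refine (mul_le_mul_of_nonneg_right hcoll (by positivity)).trans (le_of_eq ?_)
  field_simp
  ring

-- On `E` the conditional probability of `K` is at most `g`. Off `E` only the trivial bound one is
-- used.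
open Classical in
lemma sum_log_one_add_le {p : Ω → ℝ} (hp : IsWeight p) (K : Ω → κ) (Z : Ω → ζ) {N g : ℝ}
    (hN : 0 ≤ N) (hg : 0 ≤ g) (E : Ω → Prop)
    (hE : ∀ ω, 0 < p ω → E ω →
      marg p (fun ω => (K ω, Z ω)) (K ω, Z ω) ≤ g * marg p Z (Z ω)) :
    ∑ ω, p ω * Real.log (1 + N *
        (marg p (fun ω => (K ω, Z ω)) (K ω, Z ω) / marg p Z (Z ω))) ≤
      Real.log (1 + N * g) + (∑ ω, if E ω then 0 else p ω) * Real.log (1 + N) := by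
  have hl1 : 0 ≤ Real.log (1 + N * g) := Real.log_nonneg (by nlinarith [mul_nonneg hN hg])
  have hl2 : 0 ≤ Real.log (1 + N) := Real.log_nonneg (by linarith)
  have hconst : Real.log (1 + N * g) = ∑ ω, p ω * Real.log (1 + N * g) := by
    rw [← Finset.sum_mul, hp.sum_eq, one_mul]
  rw [hconst, Finset.sum_mul, ← Finset.sum_add_distrib]
  refine Finset.sum_le_sum fun ω _ => ?_
  rcases (hp.nonneg ω).eq_or_lt with h0 | h0
  · simp [← h0]
  have hz := marg_pos hp.nonneg Z h0
  have hkz := marg_nonneg hp.nonneg (fun ω => (K ω, Z ω)) (K ω, Z ω)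
  have hr : 0 ≤ marg p (fun ω => (K ω, Z ω)) (K ω, Z ω) / marg p Z (Z ω) := by positivity
  by_cases hω : E ω
  · simp only [hω, if_true, zero_mul, add_zero]
    refine mul_le_mul_of_nonneg_left (Real.log_le_log (by positivity) ?_) h0.le
    have := (div_le_iff₀ hz).2 (hE ω h0 hω)
    have := mul_le_mul_of_nonneg_left this hN
    linarith
  · simp only [hω, if_false]
    have h1 : marg p (fun ω => (K ω, Z ω)) (K ω, Z ω) / marg p Z (Z ω) ≤ 1 :=
      (div_le_one hz).2 (marg_pair_le_right hp.nonneg K Z _ _)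
    have h2 : Real.log (1 + N * (marg p (fun ω => (K ω, Z ω)) (K ω, Z ω) / marg p Z (Z ω)))
        ≤ Real.log (1 + N) := Real.log_le_log (by positivity) (by nlinarith)
    have := mul_le_mul_of_nonneg_left h2 h0.le
    nlinarith [mul_nonneg h0.le hl1]

/-- The uniform weight on a finite type. -/
def unifWeight (H : Type*) [Fintype H] (_ : H) : ℝ := 1 / Fintype.card H

lemma isWeight_unifWeight [Nonempty H] : IsWeight (unifWeight H) := by
  refine ⟨fun _ => by simp [unifWeight], ?_⟩
  simp [unifWeight]

/-- For given values away from `k`, exactly one of the `|σ|` values at `k` produces a collision. -/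
lemma isUniversal_functions [Nonempty σ] [DecidableEq κ] :
    IsUniversal (unifWeight (κ → σ)) fun h : κ → σ => h := by
  classical
  intro k k' hk
  have hc : (Fintype.card σ : ℝ) ≠ 0 := by exact_mod_cast Fintype.card_ne_zero
  have h1 : ∑ h : κ → σ, (if h k = h k' then (1 : ℝ) else 0)
      = (Fintype.card ({j // j ≠ k} → σ) : ℝ) := by
    rw [← (Equiv.funSplitAt k σ).symm.sum_comp, Fintype.sum_prod_type_right]
    simp [Equiv.funSplitAt, Equiv.piSplitAt, hk.symm]
  have h2 : (Fintype.card (κ → σ) : ℝ) = Fintype.card σ * Fintype.card ({j // j ≠ k} → σ) := by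
    rw [Fintype.card_congr (Equiv.funSplitAt k σ), Fintype.card_prod]
    push_cast; ring
  have h3 : (Fintype.card ({j // j ≠ k} → σ) : ℝ) ≠ 0 := by exact_mod_cast Fintype.card_ne_zero
  have h4 : ∀ h : κ → σ, (if h k = h k' then unifWeight (κ → σ) h else 0)
      = (if h k = h k' then (1 : ℝ) else 0) * (1 / Fintype.card (κ → σ)) := fun h => by
    split_ifs <;> simp [unifWeight]
  simp_rw [h4]
  rw [← Finset.sum_mul, h1, h2]
  refine le_of_eq ?_
  field_simp

lemma exists_le_of_sum_le {μ : H → ℝ} (hμ : IsWeight μ) {F : H → ℝ} {C : ℝ}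
    (h : ∑ i, μ i * F i ≤ C) : ∃ i, F i ≤ C := by
  by_contra! hc
  obtain ⟨i, hi⟩ : ∃ i, 0 < μ i := by
    by_contra! hn
    have := Finset.sum_nonpos fun i (_ : i ∈ Finset.univ) => hn i
    rw [hμ.sum_eq] at this
    linarith
  have h1 : ∑ i, μ i * C < ∑ i, μ i * F i :=
    Finset.sum_lt_sum (fun i _ => mul_le_mul_of_nonneg_left (hc i).le (hμ.nonneg i))
      ⟨i, Finset.mem_univ i, mul_lt_mul_of_pos_left (hc i) hi⟩
  rw [← Finset.sum_mul, hμ.sum_eq] at h1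
  linarith

end Hashing

/-! ### Product weights -/

section ProductWeights

variable {ι α β : Type*} [Fintype ι] [DecidableEq ι] [Fintype α] [Fintype β]

/-- The product weight on functions `ι → α`. -/
def prodWeight (ι : Type*) [Fintype ι] (p : α → ℝ) (c : ι → α) : ℝ := ∏ j, p (c j)

lemma sum_prod_apply (f : ι → α → ℝ) :
    ∑ c : ι → α, ∏ j, f j (c j) = ∏ j, ∑ a, f j a := by
  rw [Finset.prod_univ_sum, Fintype.piFinset_univ]

lemma isWeight_prodWeight {p : α → ℝ} (hp : IsWeight p) :
    IsWeight (prodWeight ι p) :=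
  ⟨fun c => Finset.prod_nonneg fun j _ => hp.nonneg _, by
    simp [prodWeight, sum_prod_apply (ι := ι) fun _ => p, hp.sum_eq]⟩

lemma sum_prodWeight_forall (p : α → ℝ) (E : α → Prop) [DecidablePred E] :
    ∑ c : ι → α, (if ∀ j, E (c j) then prodWeight ι p c else 0)
      = (∑ a, if E a then p a else 0) ^ Fintype.card ι := by
  have h := sum_prod_apply (ι := ι) fun _ a => if E a then p a else 0
  rw [Finset.prod_const, Finset.card_univ] at h
  rw [← h]
  refine Finset.sum_congr rfl fun c _ => ?_
  rw [prodWeight, Finset.prod_ite_zero]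
  simp

lemma sum_prodWeight_mul_apply {p : α → ℝ} (hp : IsWeight p) (k : ι) (f : α → ℝ) :
    ∑ c : ι → α, prodWeight ι p c * f (c k) = ∑ a, p a * f a := by
  classical
  have h := sum_prod_apply (ι := ι) fun j a => p a * if j = k then f a else 1
  have h1 : ∀ j, ∑ a, p a * (if j = k then f a else 1) = if j = k then ∑ a, p a * f a else 1 :=
    fun j => by split_ifs <;> simp [hp.sum_eq]
  simp_rw [h1] at h
  rw [Finset.prod_ite_eq' Finset.univ k fun _ => ∑ a, p a * f a, if_pos (Finset.mem_univ _)] at h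
  rw [← h]
  refine Finset.sum_congr rfl fun c _ => ?_
  rw [Finset.prod_mul_distrib, Finset.prod_ite_eq' Finset.univ k fun j => f (c j)]
  simp [prodWeight]

lemma marg_prodWeight (p : α → ℝ) (A : α → β) (b : ι → β) :
    marg (prodWeight ι p) (fun c j => A (c j)) b = ∏ j, marg p A (b j) := by
  classical
  have h := sum_prod_apply (ι := ι) fun j a => if A a = b j then p a else 0
  simp only [marg]
  rw [← h]
  refine Finset.sum_congr rfl fun c _ => ?_
  rw [Finset.prod_ite_zero]
  simp [funext_iff, prodWeight]

end ProductWeights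

/-- The covering estimate: `1 - y ≤ exp (-y)` bounds the power by `exp (-(a M s))`, and convexity of
`exp` between `0` and `-(M s)` takes `a` out of the exponent. -/
lemma one_sub_pow_le {a s : ℝ} (ha0 : 0 ≤ a) (ha1 : a ≤ 1) {M : ℕ} {x : ℝ} (hx0 : 0 ≤ x)
    (hx : x ≤ 1 - a * s) : x ^ M ≤ 1 - a + Real.exp (-(M * s)) := by
  have h1 : x ≤ Real.exp (-(a * s)) := hx.trans (by linarith [Real.add_one_le_exp (-(a * s))])
  have h2 : x ^ M ≤ Real.exp (-(a * s)) ^ M := pow_le_pow_left₀ hx0 h1 M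
  have h3 : Real.exp (-(a * s)) ^ M = Real.exp ((1 - a) • 0 + a • (-(M * s))) := by
    rw [← Real.exp_nat_mul]; congr 1; simp; ring
  have h4 := convexOn_exp.2 (Set.mem_univ 0) (Set.mem_univ (-(M * s))) (sub_nonneg.2 ha1) ha0
    (by ring)
  have h5 : a • Real.exp (-(M * s)) ≤ Real.exp (-(M * s)) :=
    mul_le_of_le_one_left (Real.exp_pos _).le ha1
  rw [Real.exp_zero, smul_eq_mul (1 - a) (1 : ℝ), mul_one] at h4
  linarith

/-! ### Typical outcomes and admissible codewords -/

section OneShot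

variable {U T Z X Y : Type*} [Fintype U] [Fintype T] [Fintype Z] [Fintype X] [Fintype Y]

/-- The law of `U`. -/
def lawU (p : Z → ℝ) (B : Z → T) (q : T → U → ℝ) (u : U) : ℝ :=
  marg (joint p B q) (fun ω => ω.1) u

/-- The joint law of `U` and `A`. -/
def lawUA (p : Z → ℝ) (B : Z → T) (q : T → U → ℝ) {α : Type*} (A : Z → α) (u : U) (a : α) : ℝ :=
  marg (joint p B q) (fun ω => (ω.1, A ω.2)) (u, a)

/-- The information densities of `U` with `B`, with `A` and with `C` have prescribed bounds, in
exponential form. -/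
structure Typical (p : Z → ℝ) (B : Z → T) (q : T → U → ℝ) (A : Z → X) (C : Z → Y)
    (α₁ α₂ θ τ : ℝ) (u : U) (z : Z) : Prop where
  pos : 0 < lawU p B q u
  lower : α₁ * lawU p B q u ≤ q (B z) u
  upper : q (B z) u ≤ α₂ * lawU p B q u
  left : lawUA p B q A u (A z) ≤ θ * lawU p B q u * marg p A (A z)
  right : τ * lawU p B q u * marg p C (C z) ≤ lawUA p B q C u (C z)

open Classical in
/-- Mass of the points over `t` at which `good u` fails. -/
def badMass (p : Z → ℝ) (B : Z → T) (good : U → Z → Prop) (u : U) (t : T) : ℝ :=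
  ∑ z, if B z = t ∧ ¬ good u z then p z else 0

/-- The conditional probability, given `B = t`, that `good u` fails is at most `γ`. -/
def Admissible (p : Z → ℝ) (B : Z → T) (good : U → Z → Prop) (γ : ℝ) (u : U) (t : T) : Prop :=
  0 < marg p B t ∧ badMass p B good u t ≤ γ * marg p B t

lemma badMass_nonneg {p : Z → ℝ} (hp : IsWeight p) (B : Z → T) (good : U → Z → Prop) (u : U)
    (t : T) : 0 ≤ badMass p B good u t :=
  Finset.sum_nonneg fun z _ => by split_ifs <;> simp [hp.nonneg]

/-- The bounds on `q (B z) u` contained in typicality depend on `z` only through `B z`. One good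
outcome over `t` therefore proves them for the admissible pair itself. -/
lemma Admissible.exists_good {p : Z → ℝ} {B : Z → T} {good : U → Z → Prop} {γ : ℝ} (hγ : γ < 1)
    {u : U} {t : T} (h : Admissible p B good γ u t) : ∃ z, B z = t ∧ good u z := by
  classical
  by_contra! hc
  have h1 : badMass p B good u t = marg p B t := by
    rw [badMass, marg]
    refine Finset.sum_congr rfl fun z _ => ?_
    by_cases hz : B z = t
    · simp [hz, hc z hz]
    · simp [hz]
  have := h.2
  rw [h1] at this
  nlinarith [h.1]

/-- Markov's inequality for the admissible pairs. -/
lemma sum_not_admissible_le {p : Z → ℝ} (hp : IsWeight p) (B : Z → T) {q : T → U → ℝ}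
    (hq : ∀ t, IsWeight (q t)) (good : U → Z → Prop) {γ η : ℝ} (hγ : 0 < γ) [∀ u t, Decidable
      (Admissible p B good γ u t)] [∀ u z, Decidable (good u z)]
    (hη : ∑ ω : U × Z, (if good ω.1 ω.2 then 0 else joint p B q ω) ≤ η) :
    ∑ t, marg p B t * ∑ u, (if Admissible p B good γ u t then 0 else q t u) ≤ η / γ := by
  classical
  rw [le_div_iff₀ hγ]
  refine le_trans ?_ hη
  have h1 : ∑ ω : U × Z, (if good ω.1 ω.2 then 0 else joint p B q ω)
      = ∑ t, ∑ u, badMass p B good u t * q t u := by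
    rw [Fintype.sum_prod_type, Finset.sum_comm' (t' := Finset.univ) (s' := fun _ => Finset.univ)
      (by simp) (s := Finset.univ) (t := fun _ => Finset.univ) (f := fun t u =>
        badMass p B good u t * q t u)]
    refine Finset.sum_congr rfl fun u _ => ?_
    simp only [badMass, Finset.sum_mul]
    rw [Finset.sum_comm]
    refine Finset.sum_congr rfl fun z _ => ?_
    rw [Finset.sum_eq_single (B z)]
    · by_cases h : good u z <;> simp [h, joint]
    · intro t _ ht
      simp [ht.symm]
    · simp
  rw [h1, Finset.sum_mul]
  refine Finset.sum_le_sum fun t _ => ?_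
  rw [Finset.mul_sum, Finset.sum_mul]
  refine Finset.sum_le_sum fun u _ => ?_
  have hb := badMass_nonneg hp B good u t
  have hq0 := (hq t).nonneg u
  have hm := marg_nonneg hp.nonneg B t
  split_ifs with h
  · simp; positivity
  · rcases hm.eq_or_lt with h0 | h0
    · rw [← h0]; simp; positivity
    · have : γ * marg p B t < badMass p B good u t := by
        by_contra hn
        exact h ⟨h0, not_lt.1 hn⟩
      nlinarith

end OneShot

/-! ### Random codebook, quantizer and decoding test -/

section OneShotCode

variable {U T Z X Y : Type*} [Fintype U] [Fintype T] [Fintype Z] [Fintype X] [Fintype Y]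

lemma isWeight_lawU {p : Z → ℝ} (hp : IsWeight p) (B : Z → T) {q : T → U → ℝ}
    (hq : ∀ t, IsWeight (q t)) : IsWeight (lawU p B q) :=
  (isWeight_joint hp B hq).marg _

open Classical in
lemma lawUA_eq (p : Z → ℝ) (B : Z → T) (q : T → U → ℝ) (C : Z → Y) (u : U) (y : Y) :
    lawUA p B q C u y = ∑ z, if C z = y then p z * q (B z) u else 0 := by
  rw [lawUA, marg, Fintype.sum_prod_type, Finset.sum_eq_single u]
  · refine Finset.sum_congr rfl fun z _ => ?_
    by_cases h : C z = y <;> simp [h, joint]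
  · intro u' _ hu
    simp [hu]
  · simp

lemma lawU_eq (p : Z → ℝ) (B : Z → T) (q : T → U → ℝ) (u : U) :
    lawU p B q u = ∑ z, p z * q (B z) u := by
  classical
  rw [lawU, marg, Fintype.sum_prod_type, Finset.sum_eq_single u]
  · simp [joint]
  · intro u' _ hu
    simp [hu]
  · simp

lemma lawUA_self (p : Z → ℝ) (B : Z → T) (q : T → U → ℝ) (u : U) (t : T) :
    lawUA p B q B u t = marg p B t * q t u := by
  classical
  rw [lawUA_eq, marg, Finset.sum_mul]
  refine Finset.sum_congr rfl fun z _ => ?_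
  by_cases h : B z = t <;> simp [h]

lemma sum_lawUA {p : Z → ℝ} (B : Z → T) {q : T → U → ℝ}
    (hq : ∀ t, IsWeight (q t)) (C : Z → Y) (y : Y) : ∑ u, lawUA p B q C u y = marg p C y := by
  rw [← marg_joint_snd (p := p) (B := B) hq C y,
    ← sum_marg_pair_left (joint p B q) (fun ω => ω.1) fun ω => C ω.2]
  rfl

open Classical in
/-- Probability that no codeword is admissible. -/
def failMass (p : Z → ℝ) (B : Z → T) (good : U → Z → Prop) (γ : ℝ) {M : ℕ} (c : Fin M → U) : ℝ :=
  ∑ z, if ∃ j, Admissible p B good γ (c j) (B z) then 0 else p z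

/-- Random covering: the expected failure probability of a random codebook. -/
lemma sum_failMass_le {p : Z → ℝ} (hp : IsWeight p) (B : Z → T) {q : T → U → ℝ}
    (hq : ∀ t, IsWeight (q t)) {good : U → Z → Prop} [∀ u z, Decidable (good u z)]
    {γ η α₂ : ℝ} (hγ : 0 < γ) (hγ1 : γ < 1) (hα₂ : 0 < α₂)
    (hgood : ∀ u z, good u z → q (B z) u ≤ α₂ * lawU p B q u)
    (hη : ∑ ω : U × Z, (if good ω.1 ω.2 then 0 else joint p B q ω) ≤ η) (M : ℕ) :
    ∑ c : Fin M → U, prodWeight (Fin M) (lawU p B q) c * failMass p B good γ c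
      ≤ η / γ + Real.exp (-(M * (1 / α₂))) := by
  classical
  have hU := isWeight_lawU hp B hq
  have h1 : ∑ c : Fin M → U, prodWeight (Fin M) (lawU p B q) c * failMass p B good γ c
      = ∑ z, p z * (∑ u, if ¬ Admissible p B good γ u (B z) then lawU p B q u else 0) ^ M := by
    simp only [failMass, Finset.mul_sum]
    rw [Finset.sum_comm]
    refine Finset.sum_congr rfl fun z _ => ?_
    have h := sum_prodWeight_forall (ι := Fin M) (lawU p B q)
      fun u => ¬ Admissible p B good γ u (B z)
    rw [Fintype.card_fin] at h
    rw [← h, Finset.mul_sum]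
    refine Finset.sum_congr rfl fun c _ => ?_
    by_cases hc : ∃ j, Admissible p B good γ (c j) (B z)
    · have hc' : ¬ ∀ j, ¬ Admissible p B good γ (c j) (B z) := by push Not; exact hc
      rw [if_pos hc, if_neg hc']; ring
    · have hc' : ∀ j, ¬ Admissible p B good γ (c j) (B z) := by push Not at hc; exact hc
      rw [if_neg hc, if_pos hc']; ring
  rw [h1]
  have h2 : ∀ z, 0 < p z →
      (∑ u, if ¬ Admissible p B good γ u (B z) then lawU p B q u else 0) ^ M ≤
      ∑ u, (if Admissible p B good γ u (B z) then 0 else q (B z) u)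
        + Real.exp (-(M * (1 / α₂))) := by
    intro z hz
    set t := B z
    have hsplit : ∑ u, (if Admissible p B good γ u t then 0 else q t u)
        = 1 - ∑ u, if Admissible p B good γ u t then q t u else 0 := by
      rw [← (hq t).sum_eq, ← Finset.sum_sub_distrib]
      exact Finset.sum_congr rfl fun u _ => by split_ifs <;> simp
    have hsplit' : (∑ u, if ¬ Admissible p B good γ u t then lawU p B q u else 0)
        = 1 - ∑ u, if Admissible p B good γ u t then lawU p B q u else 0 := by
      rw [← hU.sum_eq, ← Finset.sum_sub_distrib]
      exact Finset.sum_congr rfl fun u _ => by split_ifs <;> simp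
    -- On admissible pairs `q t u` is at most `α₂` times the law of `U`. So a codeword drawn from
    -- that law is admissible with at least `1 / α₂` times the probability under `q t`.
    have hle : (∑ u, if Admissible p B good γ u t then q t u else 0) * (1 / α₂)
        ≤ ∑ u, if Admissible p B good γ u t then lawU p B q u else 0 := by
      rw [Finset.sum_mul]
      refine Finset.sum_le_sum fun u _ => ?_
      split_ifs with h
      · obtain ⟨z', hz', hg⟩ := h.exists_good hγ1
        have := hgood u z' hg
        rw [hz'] at this
        rw [mul_one_div, div_le_iff₀ hα₂]
        linarith
      · simp
    rw [hsplit]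
    refine one_sub_pow_le ?_ ?_ ?_ ?_
    · exact Finset.sum_nonneg fun u _ => by split_ifs <;> simp [(hq t).nonneg]
    · rw [← (hq t).sum_eq]
      exact Finset.sum_le_sum fun u _ => by split_ifs <;> simp [(hq t).nonneg]
    · exact Finset.sum_nonneg fun u _ => by split_ifs <;> simp [hU.nonneg]
    · rw [hsplit']; linarith
  calc _ ≤ ∑ z, p z * (∑ u, (if Admissible p B good γ u (B z) then 0 else q (B z) u)
        + Real.exp (-(M * (1 / α₂)))) := by
        refine Finset.sum_le_sum fun z _ => ?_
        rcases (hp.nonneg z).eq_or_lt with h0 | h0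
        · simp [← h0]
        · exact mul_le_mul_of_nonneg_left (h2 z h0) h0.le
    _ = ∑ t, marg p B t * ∑ u, (if Admissible p B good γ u t then 0 else q t u)
        + Real.exp (-(M * (1 / α₂))) := by
        simp_rw [mul_add]
        rw [Finset.sum_add_distrib, ← Finset.sum_mul, hp.sum_eq, one_mul,
          ← sum_marg_mul p B fun t => ∑ u, if Admissible p B good γ u t then 0 else q t u]
    _ ≤ _ := by
        have := sum_not_admissible_le hp B hq good hγ hη
        linarith

/-- The decoder's test whether a codeword fits an observation. -/
def Fits (p : Z → ℝ) (B : Z → T) (q : T → U → ℝ) (C : Z → Y) (τ : ℝ) (u : U) (y : Y) : Prop :=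
  0 < lawU p B q u ∧ τ * lawU p B q u * marg p C y ≤ lawUA p B q C u y

open Classical in
/-- Expected number of codewords that fit the observation. -/
def fitCount (p : Z → ℝ) (B : Z → T) (q : T → U → ℝ) (C : Z → Y) (τ : ℝ) {M : ℕ}
    (c : Fin M → U) : ℝ :=
  ∑ z, p z * ∑ k, if Fits p B q C τ (c k) (C z) then (1 : ℝ) else 0

/-- A codeword independent of the observation fits it with probability at most `1 / τ`: the test
bounds its probability by that under the joint law, divided by `τ` times the law of the observation.
-/
lemma sum_fitCount_le {p : Z → ℝ} (hp : IsWeight p) (B : Z → T) {q : T → U → ℝ}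
    (hq : ∀ t, IsWeight (q t)) (C : Z → Y) {τ : ℝ} (hτ : 0 < τ) (M : ℕ) :
    ∑ c : Fin M → U, prodWeight (Fin M) (lawU p B q) c * fitCount p B q C τ c ≤ M / τ := by
  classical
  have hU := isWeight_lawU hp B hq
  have h1 : ∑ c : Fin M → U, prodWeight (Fin M) (lawU p B q) c * fitCount p B q C τ c
      = ∑ z, p z * ∑ k : Fin M, ∑ u, lawU p B q u *
        if Fits p B q C τ u (C z) then (1 : ℝ) else 0 := by
    simp only [fitCount, Finset.mul_sum]
    rw [Finset.sum_comm]
    refine Finset.sum_congr rfl fun z _ => ?_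
    rw [Finset.sum_comm]
    refine Finset.sum_congr rfl fun k _ => ?_
    rw [← Finset.mul_sum, ← sum_prodWeight_mul_apply (ι := Fin M) hU k, Finset.mul_sum]
    exact Finset.sum_congr rfl fun c _ => by ring
  rw [h1]
  have h2 : ∀ z, 0 < p z → ∑ u, lawU p B q u * (if Fits p B q C τ u (C z) then (1 : ℝ) else 0)
      ≤ 1 / τ := by
    intro z hz
    have hy := marg_pos hp.nonneg C hz
    have : ∀ u, lawU p B q u * (if Fits p B q C τ u (C z) then (1 : ℝ) else 0)
        ≤ lawUA p B q C u (C z) * (1 / (τ * marg p C (C z))) := fun u => by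
      have h0 : 0 ≤ lawUA p B q C u (C z) :=
        marg_nonneg (isWeight_joint hp B hq).nonneg _ _
      split_ifs with h
      · rw [mul_one, mul_one_div, le_div_iff₀ (by positivity)]
        linarith [h.2]
      · rw [mul_zero]; positivity
    refine (Finset.sum_le_sum fun u _ => this u).trans ?_
    rw [← Finset.sum_mul, sum_lawUA B hq]
    refine le_of_eq ?_
    field_simp
  calc _ ≤ ∑ z, p z * (M / τ) := by
        refine Finset.sum_le_sum fun z _ => ?_
        rcases (hp.nonneg z).eq_or_lt with h0 | h0
        · simp [← h0]
        · refine mul_le_mul_of_nonneg_left ?_ h0.le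
          refine (Finset.sum_le_sum fun k _ => h2 z h0).trans ?_
          simp [div_eq_mul_inv]
    _ = M / τ := by rw [← Finset.sum_mul, hp.sum_eq, one_mul]

open Classical in
/-- The encoder picks an admissible codeword if there is one. -/
def quantize (p : Z → ℝ) (B : Z → T) (good : U → Z → Prop) (γ : ℝ) {M : ℕ} (c : Fin M → U)
    (t : T) : Option (Fin M) :=
  if h : ∃ j, Admissible p B good γ (c j) t then some h.choose else none

lemma admissible_of_quantize {p : Z → ℝ} {B : Z → T} {good : U → Z → Prop} {γ : ℝ} {M : ℕ}
    {c : Fin M → U} {t : T} {j : Fin M} (h : quantize p B good γ c t = some j) :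
    Admissible p B good γ (c j) t := by
  unfold quantize at h
  split_ifs at h with h'
  rw [← Option.some.inj h]
  exact h'.choose_spec

lemma quantize_eq_none {p : Z → ℝ} {B : Z → T} {good : U → Z → Prop} {γ : ℝ} {M : ℕ}
    {c : Fin M → U} {t : T} :
    quantize p B good γ c t = none ↔ ¬ ∃ j, Admissible p B good γ (c j) t := by
  unfold quantize
  split_ifs with h <;> simp [h]

/-- The event that the chosen codeword exists and is good for the outcome. -/
def Success (p : Z → ℝ) (B : Z → T) (good : U → Z → Prop) (γ : ℝ) {M : ℕ} (c : Fin M → U)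
    (z : Z) : Prop :=
  ∃ j, quantize p B good γ c (B z) = some j ∧ good (c j) z

-- Without success, either no codeword is admissible or the chosen one is bad. Given `B = t` the
-- choice is fixed, and its admissibility bounds the second probability by `γ`.
open Classical in
lemma sum_not_success_le {p : Z → ℝ} (hp : IsWeight p) (B : Z → T) (good : U → Z → Prop) {γ : ℝ}
    (hγ : 0 ≤ γ) {M : ℕ} (c : Fin M → U) :
    ∑ z, (if Success p B good γ c z then 0 else p z) ≤ failMass p B good γ c + γ := by
  have h1 : ∑ z, (if ∃ j, quantize p B good γ c (B z) = some j ∧ ¬ good (c j) z then p z else 0)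
      ≤ γ := by
    have h2 : ∑ z, (if ∃ j, quantize p B good γ c (B z) = some j ∧ ¬ good (c j) z then p z else 0)
        = ∑ t, ∑ z, if B z = t ∧ ∃ j, quantize p B good γ c t = some j ∧ ¬ good (c j) z then p z
          else 0 := by
      rw [Finset.sum_comm]
      refine Finset.sum_congr rfl fun z _ => ?_
      rw [Finset.sum_eq_single (B z)]
      · simp
      · intro t _ ht
        simp [ht.symm]
      · simp
    have h3 : ∀ t, ∑ z, (if B z = t ∧ ∃ j, quantize p B good γ c t = some j ∧ ¬ good (c j) z
        then p z else 0) ≤ γ * marg p B t := by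
      intro t
      cases hq : quantize p B good γ c t with
      | none =>
        simpa using mul_nonneg hγ (marg_nonneg hp.nonneg B t)
      | some j =>
        refine le_trans (le_of_eq ?_) (admissible_of_quantize hq).2
        rw [badMass]
        refine Finset.sum_congr rfl fun z _ => ?_
        simp
    rw [h2]
    refine (Finset.sum_le_sum fun t _ => h3 t).trans ?_
    rw [← Finset.mul_sum, (hp.marg B).sum_eq, mul_one]
  refine le_trans ?_ (add_le_add le_rfl h1)
  rw [failMass, ← Finset.sum_add_distrib]
  refine Finset.sum_le_sum fun z _ => ?_
  have h0 := hp.nonneg z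
  cases hq : quantize p B good γ c (B z) with
  | none =>
    rw [quantize_eq_none] at hq
    rw [if_neg hq]
    split_ifs <;> linarith
  | some j =>
    have hs : Success p B good γ c z ↔ good (c j) z := by simp [Success, hq]
    by_cases hg : good (c j) z
    · rw [if_pos (hs.2 hg)]
      split_ifs <;> linarith
    · have h2 : ∃ j', some j = some j' ∧ ¬ good (c j') z := ⟨j, rfl, hg⟩
      rw [if_neg (fun h => hg (hs.1 h)), if_pos h2]
      split_ifs <;> linarith

variable {p : Z → ℝ} {B : Z → T} {q : T → U → ℝ} {A : Z → X} {C : Z → Y} {α₁ α₂ θ τ γ : ℝ}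

/-- Given the side information, the index of the codeword is not too likely. -/
lemma marg_quantize_pair_le {β : Type*} [Fintype β] (hp : IsWeight p) (hq : ∀ t, IsWeight (q t))
    (D : Z → β) {good : U → Z → Prop} (hα₁ : 0 < α₁)
    (hgood : ∀ u z, good u z → 0 < lawU p B q u ∧ α₁ * lawU p B q u ≤ q (B z) u) (hγ : γ < 1)
    {M : ℕ} (c : Fin M → U) (j : Fin M) (d : β) :
    lawU p B q (c j) * marg p (fun z => (quantize p B good γ c (B z), D z)) (some j, d)
      ≤ lawUA p B q D (c j) d / α₁ := by
  classical
  rw [le_div_iff₀ hα₁, lawUA_eq, marg, Finset.mul_sum, Finset.sum_mul]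
  refine Finset.sum_le_sum fun z _ => ?_
  have hp0 := hp.nonneg z
  by_cases hd : D z = d
  · by_cases hk : quantize p B good γ c (B z) = some j
    -- `z'` lies over the same point as `z`, so its lower bound on the channel probability applies
    -- to `z`.
    · obtain ⟨z', hz', hg⟩ := (admissible_of_quantize hk).exists_good hγ
      have := (hgood _ _ hg).2
      rw [hz'] at this
      simp only [hd, hk, if_true]
      nlinarith [mul_le_mul_of_nonneg_left this hp0]
    · simp only [hd, hk, Prod.mk.injEq, false_and, if_false, if_true]
      simpa using mul_nonneg hp0 ((hq _).nonneg _)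
  · simp [hd]

end OneShotCode

/-! ### One-shot bounds on error, leakage and key secrecy -/

section OneShotBound

variable {U T Z X Y : Type*} [Fintype U] [Fintype T] [Fintype Z] [Fintype X] [Fintype Y]
variable {p : Z → ℝ} {B : Z → T} {q : T → U → ℝ} {A : Z → X} {C : Z → Y} {α₁ α₂ θ τ γ : ℝ}

open Classical in
/-- The decoder returns the only codeword in the given bin that fits the observation. -/
def binDecode (p : Z → ℝ) (B : Z → T) (q : T → U → ℝ) (C : Z → Y) (τ : ℝ) {M : ℕ} {σ : Type*}
    (c : Fin M → U) (b : Option (Fin M) → σ) (w : σ) (y : Y) : Option (Fin M) :=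
  if h : ∃! k, b (some k) = w ∧ Fits p B q C τ (c k) y then some h.choose else none

lemma binDecode_eq {M : ℕ} {σ : Type*} {c : Fin M → U} {b : Option (Fin M) → σ} {y : Y} {j : Fin M}
    (hj : Fits p B q C τ (c j) y)
    (h : ∀ k, k ≠ j → ¬ (b (some k) = b (some j) ∧ Fits p B q C τ (c k) y)) :
    binDecode p B q C τ c b (b (some j)) y = some j := by
  have hu : ∃! k, b (some k) = b (some j) ∧ Fits p B q C τ (c k) y :=
    ⟨j, ⟨rfl, hj⟩, fun k hk => by_contra fun hne => h k hne hk⟩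
  rw [binDecode, dif_pos hu]
  exact congrArg some (hu.unique hu.choose_spec.1 ⟨rfl, hj⟩)

open Classical in
/-- Probability that the decoder does not recover the index of the codeword. -/
def binError (p : Z → ℝ) (B : Z → T) (q : T → U → ℝ) (C : Z → Y) (τ : ℝ) (good : U → Z → Prop)
    (γ : ℝ) {M : ℕ} {σ : Type*} (c : Fin M → U) (b : Option (Fin M) → σ) : ℝ :=
  ∑ z, if binDecode p B q C τ c b (b (quantize p B good γ c (B z))) (C z)
    = quantize p B good γ c (B z) then 0 else p z

/-- Random binning: the average error probability. -/
lemma sum_binError_le {σ H : Type*} [Fintype σ] [Fintype H] (hp : IsWeight p)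
    {good : U → Z → Prop} (hgood : ∀ u z, good u z → Fits p B q C τ u (C z)) (hγ : 0 ≤ γ) {M : ℕ}
    (c : Fin M → U) {μ : H → ℝ} (hμ : IsWeight μ) {b : H → Option (Fin M) → σ}
    (hb : IsUniversal μ b) :
    ∑ i, μ i * binError p B q C τ good γ c (b i)
      ≤ failMass p B good γ c + γ + fitCount p B q C τ c / Fintype.card σ := by
  classical
  set K : Z → Option (Fin M) := fun z => quantize p B good γ c (B z) with hK
  have h1 : ∀ i, binError p B q C τ good γ c (b i) ≤
      ∑ z, (if Success p B good γ c z then 0 else p z) +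
      ∑ z, p z * ∑ k, if Fits p B q C τ (c k) (C z) then
        (if some k ≠ K z ∧ b i (some k) = b i (K z) then (1 : ℝ) else 0) else 0 := by
    intro i
    rw [binError, ← Finset.sum_add_distrib]
    refine Finset.sum_le_sum fun z _ => ?_
    have hp0 := hp.nonneg z
    have hnn : 0 ≤ ∑ k, if Fits p B q C τ (c k) (C z) then
        (if some k ≠ K z ∧ b i (some k) = b i (K z) then (1 : ℝ) else 0) else 0 :=
      Finset.sum_nonneg fun k _ => by split_ifs <;> norm_num
    by_cases hs : Success p B good γ c z
    · rw [if_pos hs, zero_add]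
      split_ifs with hd
      · exact mul_nonneg hp0 hnn
      · obtain ⟨j, hj, hg⟩ := hs
        -- The correct index fits its own bin, so an error requires a second fitting codeword in
        -- that bin.
        have : ∃ k, k ≠ j ∧ b i (some k) = b i (some j) ∧ Fits p B q C τ (c k) (C z) := by
          by_contra! hc
          refine hd ?_
          rw [hj]
          exact binDecode_eq (hgood _ _ hg) fun k hk h => hc k hk h.1 h.2
        obtain ⟨k, hk, hbk, hf⟩ := this
        have hone : (1 : ℝ) ≤ ∑ k, if Fits p B q C τ (c k) (C z) then
            (if some k ≠ K z ∧ b i (some k) = b i (K z) then (1 : ℝ) else 0) else 0 := by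
          refine le_trans (le_of_eq ?_) (Finset.single_le_sum (fun k _ => ?_) (Finset.mem_univ k))
          · have : some k ≠ K z ∧ b i (some k) = b i (K z) := by
              simp only [hK, hj]
              exact ⟨fun h => hk (Option.some.inj h), hbk⟩
            rw [if_pos hf, if_pos this]
          · split_ifs <;> norm_num
        nlinarith
    · rw [if_neg hs]
      have := mul_nonneg hp0 hnn
      split_ifs <;> linarith
  have h2 : ∑ i, μ i * ∑ z, p z * ∑ k, (if Fits p B q C τ (c k) (C z) then
        (if some k ≠ K z ∧ b i (some k) = b i (K z) then (1 : ℝ) else 0) else 0)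
      ≤ fitCount p B q C τ c / Fintype.card σ := by
    simp only [fitCount, Finset.mul_sum, Finset.sum_div]
    rw [Finset.sum_comm]
    refine Finset.sum_le_sum fun z _ => ?_
    rw [Finset.sum_comm]
    refine Finset.sum_le_sum fun k _ => ?_
    by_cases hf : Fits p B q C τ (c k) (C z)
    · simp only [hf, if_true]
      by_cases hk : some k = K z
      · simp only [hk, ne_eq, not_true_eq_false, false_and, if_false, mul_zero,
          Finset.sum_const_zero]
        have := hp.nonneg z
        positivity
      · have h3 := mul_le_mul_of_nonneg_left (hb _ _ hk) (hp.nonneg z)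
        refine le_trans (le_of_eq ?_) (h3.trans (le_of_eq (by ring)))
        rw [Finset.mul_sum]
        refine Finset.sum_congr rfl fun i _ => ?_
        simp only [ne_eq, hk, not_false_eq_true, true_and]
        split_ifs <;> ring
    · simp [hf]
  have h4 := sum_not_success_le hp B good hγ c
  calc _ ≤ ∑ i, μ i * (∑ z, (if Success p B good γ c z then 0 else p z) +
      ∑ z, p z * ∑ k, if Fits p B q C τ (c k) (C z) then
        (if some k ≠ K z ∧ b i (some k) = b i (K z) then (1 : ℝ) else 0) else 0) :=
        Finset.sum_le_sum fun i _ => mul_le_mul_of_nonneg_left (h1 i) (hμ.nonneg i)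
    _ ≤ _ := by
        simp_rw [mul_add]
        rw [Finset.sum_add_distrib, ← Finset.sum_mul, hμ.sum_eq, one_mul]
        linarith

/-- Leftover hashing with side information `A`: on success, the typicality bounds give every index
conditional probability at most `θ / α₁`. -/
lemma sum_binLeakage_le {σ H : Type*} [Fintype σ] [Fintype H] (hp : IsWeight p)
    (hq : ∀ t, IsWeight (q t)) (hα₁ : 0 < α₁) (hθ : 0 ≤ θ) (hγ : 0 ≤ γ) (hγ1 : γ < 1) {M : ℕ}
    (c : Fin M → U) {μ : H → ℝ} (hμ : IsWeight μ) {b : H → Option (Fin M) → σ}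
    (hb : IsUniversal μ b) :
    ∑ i, μ i * deficit p
        (fun z => b i (quantize p B (Typical p B q A C α₁ α₂ θ τ) γ c (B z))) A
      ≤ Real.log (1 + Fintype.card σ * (θ / α₁)) +
        (failMass p B (Typical p B q A C α₁ α₂ θ τ) γ c + γ) *
          Real.log (1 + Fintype.card σ) := by
  classical
  set good := Typical p B q A C α₁ α₂ θ τ
  refine (leftover_hash hμ hb hp (fun z => quantize p B good γ c (B z)) A).trans ?_
  have h := sum_log_one_add_le hp (fun z => quantize p B good γ c (B z)) A
    (N := Fintype.card σ) (g := θ / α₁) (by positivity) (by positivity)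
    (fun z => Success p B good γ c z) (fun z _ hs => by
      obtain ⟨j, hj, hg⟩ := hs
      have h1 := marg_quantize_pair_le hp hq A hα₁ (good := good)
        (fun u z h => ⟨h.pos, h.lower⟩) hγ1 c j (A z)
      rw [hj]
      have h2 := h1.trans (div_le_div_of_nonneg_right hg.left hα₁.le)
      have h3 := hg.pos
      refine le_of_mul_le_mul_left (h2.trans (le_of_eq ?_)) h3
      ring)
  refine h.trans (add_le_add le_rfl (mul_le_mul_of_nonneg_right
    (sum_not_success_le hp B good hγ c) (Real.log_nonneg ?_)))
  have : (0 : ℝ) ≤ Fintype.card σ := by positivity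
  linarith

/-- Leftover hashing with the bin number as side information. An index and its bin have joint mass
at most `1 / α₁`, and bins of mass below `1 / (|ρ| ξ)` have total mass at most `1 / ξ`. The bins are
arbitrary, so the key hash can be chosen after them. -/
lemma sum_binKey_le {σ ρ H : Type*} [Fintype σ] [Fintype ρ] [Fintype H] (hp : IsWeight p)
    (hq : ∀ t, IsWeight (q t)) {good : U → Z → Prop} (hα₁ : 0 < α₁)
    (hgood : ∀ u z, good u z → 0 < lawU p B q u ∧ α₁ * lawU p B q u ≤ q (B z) u) (hγ1 : γ < 1)
    {M : ℕ} (c : Fin M → U) (b : Option (Fin M) → ρ) {ξ : ℝ} (hξ : 0 < ξ)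
    {μ : H → ℝ} (hμ : IsWeight μ) {h : H → Option (Fin M) → σ} (hh : IsUniversal μ h) :
    ∑ i, μ i * deficit p (fun z => h i (quantize p B good γ c (B z)))
        (fun z => b (quantize p B good γ c (B z)))
      ≤ Real.log (1 + Fintype.card σ * (Fintype.card ρ * ξ / α₁)) +
        (failMass p B good γ c + 1 / ξ) * Real.log (1 + Fintype.card σ) := by
  classical
  set K : Z → Option (Fin M) := fun z => quantize p B good γ c (B z) with hK
  set W : Z → ρ := fun z => b (K z)
  have hρ : Nonempty ρ := hp.nonempty.map W
  have hc : (0 : ℝ) < Fintype.card ρ := by exact_mod_cast Fintype.card_pos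
  refine (leftover_hash hμ hh hp K W).trans ?_
  have h1 := sum_log_one_add_le hp K W
    (N := Fintype.card σ) (g := Fintype.card ρ * ξ / α₁) (by positivity) (by positivity)
    (fun z => K z ≠ none ∧ 1 / (Fintype.card ρ * ξ) ≤ marg p W (W z)) (fun z _ hs => by
      obtain ⟨j, hj⟩ := Option.ne_none_iff_exists'.1 hs.1
      have h1 := marg_quantize_pair_le hp hq W hα₁ hgood hγ1 c j (W z)
      obtain ⟨z', hz', hg⟩ := (admissible_of_quantize hj).exists_good hγ1
      have h2 := (hgood _ _ hg).1
      have h3 : lawUA p B q W (c j) (W z) ≤ lawU p B q (c j) :=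
        marg_pair_le_left (isWeight_joint hp B hq).nonneg _ _ _ _
      rw [hj]
      have h4 := h1.trans (div_le_div_of_nonneg_right h3 hα₁.le)
      have h5 : marg p (fun z => (K z, W z)) (some j, W z) ≤ 1 / α₁ :=
        le_of_mul_le_mul_left (h4.trans (le_of_eq (by ring))) h2
      refine h5.trans ?_
      have h6 := mul_le_mul_of_nonneg_left hs.2
        (show 0 ≤ Fintype.card ρ * ξ / α₁ by positivity)
      refine le_trans (le_of_eq ?_) h6
      field_simp)
  refine h1.trans (add_le_add le_rfl (mul_le_mul_of_nonneg_right ?_ (Real.log_nonneg ?_)))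
  · have h2 : ∑ z, (if 1 / (Fintype.card ρ * ξ) ≤ marg p W (W z) then 0 else p z) ≤ 1 / ξ := by
      have h3 := sum_marg_mul p W
        fun w => if 1 / (Fintype.card ρ * ξ) ≤ marg p W w then (0 : ℝ) else 1
      simp only [mul_ite, mul_zero, mul_one] at h3
      rw [← h3]
      refine (Finset.sum_le_sum (g := fun _ => 1 / (Fintype.card ρ * ξ)) fun w _ => ?_).trans ?_
      · split_ifs with h
        · positivity
        · exact (not_le.1 h).le
      · rw [Finset.sum_const, Finset.card_univ, nsmul_eq_mul]
        refine le_of_eq ?_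
        field_simp
    refine le_trans ?_ (add_le_add le_rfl h2)
    rw [failMass, ← Finset.sum_add_distrib]
    refine Finset.sum_le_sum fun z _ => ?_
    have hp0 := hp.nonneg z
    by_cases hn : K z = none
    · have := quantize_eq_none.1 hn
      rw [if_neg this, if_neg (fun h => h.1 hn)]
      split_ifs <;> linarith
    · have : ∃ j, Admissible p B good γ (c j) (B z) := by
        by_contra h
        exact hn (quantize_eq_none.2 h)
      rw [if_pos this]
      simp [hn]
  · have : (0 : ℝ) ≤ Fintype.card σ := by positivity
    linarith

open Classical in
/-- One-shot key agreement: existence of a code with explicit bounds on the leakage and error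
probability and on the secrecy and uniformity of the key. -/
lemma exists_oneShot_code (hp : IsWeight p) (hq : ∀ t, IsWeight (q t)) {η ξ ν : ℝ}
    (hα₁ : 0 < α₁) (hα₂ : 0 < α₂) (hθ : 0 ≤ θ) (hτ : 0 < τ) (hγ : 0 < γ) (hγ1 : γ < 1)
    (hξ : 0 < ξ) (hν : 0 ≤ ν)
    (hη : ∑ ω : U × Z, (if Typical p B q A C α₁ α₂ θ τ ω.1 ω.2 then 0 else joint p B q ω) ≤ η)
    (M MW MS : ℕ) [NeZero MW] [NeZero MS] {e : ℝ}
    (he : η / γ + Real.exp (-(M * (1 / α₂))) + M / τ / MW + γ ≤ e) :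
    ∃ (f : T → Fin MW × Fin MS) (g : Fin MW × Y → Fin MS),
      deficit p (fun z => (f (B z)).1) A +
          ν * (∑ z, if (f (B z)).2 = g ((f (B z)).1, C z) then 0 else p z)
        ≤ Real.log (1 + MW * (θ / α₁)) + e * Real.log (1 + MW) + ν * e ∧
      deficit p (fun z => (f (B z)).2) (fun z => (f (B z)).1)
        ≤ Real.log (1 + MS * (MW * ξ / α₁)) + (e + 1 / ξ) * Real.log (1 + MS) := by
  set good := Typical p B q A C α₁ α₂ θ τ with hgood
  have hMW : (0 : ℝ) < MW := by exact_mod_cast Nat.pos_of_ne_zero (NeZero.ne MW)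
  have hU := isWeight_lawU hp B hq
  have hl1 : 0 ≤ Real.log (1 + (MW : ℝ)) := Real.log_nonneg (by linarith)
  have hl2 : 0 ≤ Real.log (1 + (MS : ℝ)) :=
    Real.log_nonneg (by have : (0 : ℝ) ≤ MS := by positivity
                        linarith)
  obtain ⟨c, hc⟩ : ∃ c : Fin M → U, failMass p B good γ c + fitCount p B q C τ c / MW ≤
      η / γ + Real.exp (-(M * (1 / α₂))) + M / τ / MW := by
    refine exists_le_of_sum_le (isWeight_prodWeight (ι := Fin M) hU) ?_
    have h1 : ∀ c : Fin M → U, prodWeight (Fin M) (lawU p B q) c *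
        (failMass p B good γ c + fitCount p B q C τ c / MW)
        = prodWeight (Fin M) (lawU p B q) c * failMass p B good γ c +
          prodWeight (Fin M) (lawU p B q) c * fitCount p B q C τ c / MW := fun c => by ring
    simp_rw [h1]
    rw [Finset.sum_add_distrib, ← Finset.sum_div]
    exact add_le_add (sum_failMass_le hp B hq hγ hγ1 hα₂ (fun u z h => h.upper) hη M)
      (div_le_div_of_nonneg_right (sum_fitCount_le hp B hq C hτ M) hMW.le)
  have hfit : 0 ≤ fitCount p B q C τ c / MW := by
    refine div_nonneg (Finset.sum_nonneg fun z _ => mul_nonneg (hp.nonneg z)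
      (Finset.sum_nonneg fun k _ => ?_)) hMW.le
    split_ifs <;> norm_num
  -- Leakage and error are averaged as one sum, so a single binning controls both without a constant
  -- factor lost in the leakage. A large `ν` recovers the error.
  obtain ⟨b, hb⟩ : ∃ b : Option (Fin M) → Fin MW,
      deficit p (fun z => b (quantize p B good γ c (B z))) A
        + ν * binError p B q C τ good γ c b
        ≤ Real.log (1 + MW * (θ / α₁)) + e * Real.log (1 + MW) + ν * e := by
    refine exists_le_of_sum_le (isWeight_unifWeight (H := Option (Fin M) → Fin MW)) ?_
    have h1 := sum_binLeakage_le (A := A) (C := C) (α₂ := α₂) (τ := τ) (B := B) hp hq hα₁ hθ hγ.le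
      hγ1 c (isWeight_unifWeight (H := Option (Fin M) → Fin MW)) isUniversal_functions
    have h2 := sum_binError_le (B := B) (q := q) (C := C) (τ := τ) hp (good := good)
      (fun u z h => ⟨h.pos, h.right⟩) hγ.le
      c (isWeight_unifWeight (H := Option (Fin M) → Fin MW)) isUniversal_functions
    rw [Fintype.card_fin] at h1 h2
    have h3 : ∀ b : Option (Fin M) → Fin MW, unifWeight _ b *
        (deficit p (fun z => b (quantize p B good γ c (B z))) A
          + ν * binError p B q C τ good γ c b)
        = unifWeight _ b * deficit p (fun z => b (quantize p B good γ c (B z))) A +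
          ν * (unifWeight _ b * binError p B q C τ good γ c b) := fun b => by ring
    simp_rw [h3]
    rw [Finset.sum_add_distrib, ← Finset.mul_sum]
    refine add_le_add (h1.trans (add_le_add le_rfl (mul_le_mul_of_nonneg_right ?_ hl1)))
      (mul_le_mul_of_nonneg_left (h2.trans ?_) hν)
    · linarith
    · linarith
  obtain ⟨h, hh⟩ : ∃ h : Option (Fin M) → Fin MS,
      deficit p (fun z => h (quantize p B good γ c (B z)))
        (fun z => b (quantize p B good γ c (B z)))
        ≤ Real.log (1 + MS * (MW * ξ / α₁)) + (e + 1 / ξ) * Real.log (1 + MS) := by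
    refine exists_le_of_sum_le (isWeight_unifWeight (H := Option (Fin M) → Fin MS)) ?_
    have h1 := sum_binKey_le (B := B) hp hq (good := good) hα₁ (fun u z h => ⟨h.pos, h.lower⟩) hγ1
      c b hξ (isWeight_unifWeight (H := Option (Fin M) → Fin MS)) isUniversal_functions
    rw [Fintype.card_fin, Fintype.card_fin] at h1
    refine h1.trans (add_le_add le_rfl (mul_le_mul_of_nonneg_right ?_ hl2))
    linarith
  refine ⟨fun t => (b (quantize p B good γ c t), h (quantize p B good γ c t)),
    fun wy => h (binDecode p B q C τ c b wy.1 wy.2), ?_, hh⟩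
  -- Whatever the hash, the keys agree whenever the index is decoded correctly.
  refine le_trans (add_le_add le_rfl (mul_le_mul_of_nonneg_left ?_ hν)) hb
  rw [binError]
  refine Finset.sum_le_sum fun z _ => ?_
  have hp0 := hp.nonneg z
  by_cases hd : binDecode p B q C τ c b (b (quantize p B good γ c (B z))) (C z)
      = quantize p B good γ c (B z)
  · simp [hd]
  · rw [if_neg hd]
    split_ifs <;> linarith

end OneShotBound

/-! ### Exponential tail bounds -/

section Chernoff

variable {Ω : Type*} [Fintype Ω]

/-- The moment generating function has value one and negative derivative at zero. -/
lemma exists_expMoment_lt_one {r : Ω → ℝ} (hr : IsWeight r) {g : Ω → ℝ}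
    (hg : ∑ ω, r ω * g ω < 0) : ∃ t : ℝ, 0 < t ∧ ∑ ω, r ω * Real.exp (t * g ω) < 1 := by
  have h1 : HasDerivAt (fun t : ℝ => ∑ ω, r ω * Real.exp (t * g ω)) (∑ ω, r ω * g ω) 0 := by
    refine HasDerivAt.fun_sum fun ω _ => ?_
    have h2 : HasDerivAt (fun t : ℝ => t * g ω) (g ω) 0 := by
      simpa using (hasDerivAt_id (0 : ℝ)).mul_const (g ω)
    simpa using (h2.exp).const_mul (r ω)
  rw [hasDerivAt_iff_tendsto_slope] at h1
  have h3 := h1.eventually_lt_const hg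
  have h4 : ∀ᶠ t in nhdsWithin (0 : ℝ) (Set.Ioi 0),
      slope (fun t : ℝ => ∑ ω, r ω * Real.exp (t * g ω)) 0 t < 0 :=
    h3.filter_mono (nhdsWithin_mono _ fun t ht => ne_of_gt ht)
  obtain ⟨t, ht, ht0⟩ := (h4.and self_mem_nhdsWithin).exists
  refine ⟨t, ht0, ?_⟩
  rw [slope_def_field, sub_zero, div_neg_iff] at ht
  have ht0' : 0 < t := ht0
  rcases ht with ht | ht
  · linarith [ht.2]
  · simpa [hr.sum_eq] using ht.1

open Classical in
/-- Chernoff bound for the empirical mean of an i.i.d. sequence. -/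
lemma exists_chernoff {r : Ω → ℝ} (hr : IsWeight r) (f : Ω → ℝ) {ε : ℝ} (hε : 0 < ε) :
    ∃ d : ℝ, 0 ≤ d ∧ d < 1 ∧ ∀ n : ℕ, ∑ ω : Fin n → Ω,
      (if n * (∑ a, r a * f a + ε) < ∑ i, f (ω i) then prodWeight (Fin n) r ω else 0) ≤ d ^ n := by
  set m := ∑ a, r a * f a with hm
  obtain ⟨t, ht, htlt⟩ := exists_expMoment_lt_one hr (g := fun a => f a - (m + ε)) (by
    simp_rw [mul_sub]
    rw [Finset.sum_sub_distrib, ← Finset.sum_mul, hr.sum_eq, one_mul, ← hm]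
    linarith)
  refine ⟨_, Finset.sum_nonneg fun a _ => mul_nonneg (hr.nonneg a) (Real.exp_pos _).le, htlt,
    fun n => ?_⟩
  have h := sum_prod_apply (ι := Fin n) fun _ a => r a * Real.exp (t * (f a - (m + ε)))
  rw [Finset.prod_const, Finset.card_univ, Fintype.card_fin] at h
  rw [← h]
  refine Finset.sum_le_sum fun ω _ => ?_
  rw [Finset.prod_mul_distrib, ← Real.exp_sum]
  have h0 : 0 ≤ prodWeight (Fin n) r ω := (isWeight_prodWeight hr).nonneg ω
  change _ ≤ prodWeight (Fin n) r ω * _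
  split_ifs with hlt
  · refine le_mul_of_one_le_right h0 (Real.one_le_exp ?_)
    rw [← Finset.mul_sum, Finset.sum_sub_distrib]
    refine mul_nonneg ht.le ?_
    simp only [Finset.sum_const, Finset.card_univ, Fintype.card_fin, nsmul_eq_mul]
    linarith
  · exact mul_nonneg h0 (Real.exp_pos _).le

end Chernoff

/-! ### Information density and data processing -/

section InfoDensity

variable {U T Z X Y : Type*} [Fintype U] [Fintype T] [Fintype Z] [Fintype X] [Fintype Y]

/-- Information density of `U` and `A`. -/
def infoDensity (p : Z → ℝ) (B : Z → T) (q : T → U → ℝ) (A : Z → X) (ω : U × Z) : ℝ :=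
  Real.log (lawUA p B q A ω.1 (A ω.2) / (lawU p B q ω.1 * marg p A (A ω.2)))

/-- Mutual information of `U` and `A`. -/
def info (p : Z → ℝ) (B : Z → T) (q : T → U → ℝ) (A : Z → X) : ℝ :=
  ent (joint p B q) (fun ω => ω.1) + ent (joint p B q) (fun ω => A ω.2)
    - ent (joint p B q) fun ω => (ω.1, A ω.2)

variable {p : Z → ℝ} {B : Z → T} {q : T → U → ℝ}

lemma lawU_pos (hp : IsWeight p) (hq : ∀ t, IsWeight (q t)) {ω : U × Z}
    (h : 0 < joint p B q ω) : 0 < lawU p B q ω.1 :=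
  marg_pos (isWeight_joint hp B hq).nonneg (fun ω => ω.1) h

lemma lawUA_pos (hp : IsWeight p) (hq : ∀ t, IsWeight (q t)) (A : Z → X) {ω : U × Z}
    (h : 0 < joint p B q ω) : 0 < lawUA p B q A ω.1 (A ω.2) :=
  marg_pos (isWeight_joint hp B hq).nonneg (fun ω => (ω.1, A ω.2)) h

lemma pos_of_joint_pos (hp : IsWeight p) (hq : ∀ t, IsWeight (q t)) {ω : U × Z}
    (h : 0 < joint p B q ω) : 0 < p ω.2 ∧ 0 < q (B ω.2) ω.1 := by
  have h1 := hp.nonneg ω.2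
  have h2 := (hq (B ω.2)).nonneg ω.1
  constructor
  · refine h1.lt_of_ne fun h0 => ?_
    simp [joint, ← h0] at h
  · refine h2.lt_of_ne fun h0 => ?_
    simp [joint, ← h0] at h

lemma sum_infoDensity (hp : IsWeight p) (hq : ∀ t, IsWeight (q t)) (A : Z → X) :
    ∑ ω, joint p B q ω * infoDensity p B q A ω = info p B q A := by
  rw [info, ent_eq, ent_eq, ent_eq, sub_neg_eq_add, ← Finset.sum_neg_distrib,
    ← Finset.sum_neg_distrib, ← Finset.sum_add_distrib, ← Finset.sum_add_distrib]
  refine Finset.sum_congr rfl fun ω _ => ?_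
  rcases ((isWeight_joint hp B hq).nonneg ω).eq_or_lt with h | h
  · simp [← h]
  have h1 := lawU_pos hp hq h
  have h2 := lawUA_pos hp hq A h
  have h3 := marg_pos hp.nonneg A (pos_of_joint_pos hp hq h).1
  rw [infoDensity, Real.log_div h2.ne' (by positivity), Real.log_mul h1.ne' h3.ne',
    marg_joint_snd hq]
  change joint p B q ω * (Real.log (lawUA p B q A ω.1 (A ω.2)) - _) =
    -(joint p B q ω * Real.log (lawU p B q ω.1)) + _
      + joint p B q ω * Real.log (lawUA p B q A ω.1 (A ω.2))
  ring

lemma infoDensity_self (hp : IsWeight p) (hq : ∀ t, IsWeight (q t)) {ω : U × Z}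
    (h : 0 < joint p B q ω) :
    infoDensity p B q B ω = Real.log (q (B ω.2) ω.1 / lawU p B q ω.1) := by
  have h1 := lawU_pos hp hq h
  have h3 := marg_pos hp.nonneg B (pos_of_joint_pos hp hq h).1
  rw [infoDensity, lawUA_self]
  congr 1
  field_simp

lemma info_nonneg (hp : IsWeight p) (hq : ∀ t, IsWeight (q t)) (A : Z → X) :
    0 ≤ info p B q A := by
  have := ent_pair_le (isWeight_joint hp B hq) (fun ω => ω.1) fun ω => A ω.2
  rw [info]
  linarith

/-- Data processing inequality. -/
lemma info_le_info_self (hp : IsWeight p) (hq : ∀ t, IsWeight (q t)) (C : Z → Y) :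
    info p B q C ≤ info p B q B := by
  have hj := isWeight_joint hp B hq
  -- The ratio of P(u | c) to the channel probability of `u` has mean at most one, since P(· | c)
  -- has total mass one.
  have h := sum_mul_log_nonpos hj
    (f := fun ω => lawUA p B q C ω.1 (C ω.2) / (marg p C (C ω.2) * q (B ω.2) ω.1))
    (fun ω h => by
      have h2 := lawUA_pos hp hq C h
      have h3 := marg_pos hp.nonneg C (pos_of_joint_pos hp hq h).1
      have h4 := (pos_of_joint_pos hp hq h).2
      positivity)
    (by
      rw [Fintype.sum_prod_type_right]
      have h5 : ∀ z, ∑ u, joint p B q (u, z) *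
          (lawUA p B q C u (C z) / (marg p C (C z) * q (B z) u)) ≤ p z := fun z => by
        rcases (hp.nonneg z).eq_or_lt with h0 | h0
        · simp [joint, ← h0]
        have h3 := marg_pos hp.nonneg C h0
        have h6 : ∀ u, joint p B q (u, z) *
            (lawUA p B q C u (C z) / (marg p C (C z) * q (B z) u)) ≤
            lawUA p B q C u (C z) * (p z / marg p C (C z)) := fun u => by
          have h7 : 0 ≤ lawUA p B q C u (C z) := marg_nonneg hj.nonneg _ _
          rcases ((hq (B z)).nonneg u).eq_or_lt with h8 | h8
          · simp only [joint, ← h8, mul_zero, zero_mul]; positivity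
          · refine le_of_eq ?_
            simp only [joint]
            field_simp
        refine (Finset.sum_le_sum fun u _ => h6 u).trans ?_
        rw [← Finset.sum_mul, sum_lawUA B hq]
        refine le_of_eq ?_
        field_simp
      refine (Finset.sum_le_sum fun z _ => h5 z).trans ?_
      rw [hp.sum_eq])
  rw [← sum_infoDensity hp hq, ← sum_infoDensity hp hq]
  rw [← sub_nonpos, ← Finset.sum_sub_distrib]
  refine le_trans (le_of_eq (Finset.sum_congr rfl fun ω _ => ?_)) h
  rcases (hj.nonneg ω).eq_or_lt with h | h
  · simp [← h]
  have h1 := lawU_pos hp hq h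
  have h2 := lawUA_pos hp hq C h
  have h3 := marg_pos hp.nonneg C (pos_of_joint_pos hp hq h).1
  have h4 := (pos_of_joint_pos hp hq h).2
  rw [infoDensity_self hp hq h, infoDensity, ← mul_sub, ← Real.log_div (by positivity)
    (by positivity)]
  congr 2
  field_simp

end InfoDensity

/-! ### Memoryless extensions and typical blocks -/

section BlockSource

variable {U T Z X Y : Type*} [Fintype U] [Fintype T] [Fintype Z] [Fintype X] [Fintype Y]
variable (n : ℕ)

/-- The memoryless extension of a channel. -/
def prodChannel (q : T → U → ℝ) (t : Fin n → T) (u : Fin n → U) : ℝ := ∏ i, q (t i) (u i)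

/-- Letterwise application of a map. -/
def lift (A : Z → X) (z : Fin n → Z) : Fin n → X := fun i => A (z i)

lemma isWeight_prodChannel {q : T → U → ℝ} (hq : ∀ t, IsWeight (q t)) (t : Fin n → T) :
    IsWeight (prodChannel n q t) :=
  ⟨fun u => Finset.prod_nonneg fun i _ => (hq _).nonneg _, by
    simp [prodChannel, sum_prod_apply (ι := Fin n) fun i => q (t i), (hq _).sum_eq]⟩

variable (p : Z → ℝ) (B : Z → T) (q : T → U → ℝ)

lemma joint_prod (u : Fin n → U) (z : Fin n → Z) :
    joint (prodWeight (Fin n) p) (lift n B) (prodChannel n q) (u, z)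
      = ∏ i, joint p B q (u i, z i) := by
  simp [joint, prodWeight, prodChannel, lift, Finset.prod_mul_distrib]

lemma lawU_prod (u : Fin n → U) :
    lawU (prodWeight (Fin n) p) (lift n B) (prodChannel n q) u = ∏ i, lawU p B q (u i) := by
  simp_rw [lawU_eq]
  rw [← sum_prod_apply (ι := Fin n) fun i z => p z * q (B z) (u i)]
  simp [prodWeight, prodChannel, lift, Finset.prod_mul_distrib]

lemma lawUA_prod (A : Z → X) (u : Fin n → U) (x : Fin n → X) :
    lawUA (prodWeight (Fin n) p) (lift n B) (prodChannel n q) (lift n A) u x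
      = ∏ i, lawUA p B q A (u i) (x i) := by
  classical
  simp_rw [lawUA_eq]
  rw [← sum_prod_apply (ι := Fin n) fun i z => if A z = x i then p z * q (B z) (u i) else 0]
  refine Finset.sum_congr rfl fun z _ => ?_
  rw [Finset.prod_ite_zero]
  simp [prodWeight, prodChannel, lift, Finset.prod_mul_distrib, funext_iff]

lemma marg_lift (A : Z → X) (x : Fin n → X) :
    marg (prodWeight (Fin n) p) (lift n A) x = ∏ i, marg p A (x i) :=
  marg_prodWeight p A x

variable {p B q}

lemma exp_sum_infoDensity (hp : IsWeight p) (hq : ∀ t, IsWeight (q t)) (D : Z → X)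
    {u : Fin n → U} {z : Fin n → Z} (hpos : ∀ i, 0 < joint p B q (u i, z i)) :
    Real.exp (∑ i, infoDensity p B q D (u i, z i)) * (∏ i, lawU p B q (u i)) *
      ∏ i, marg p D (D (z i)) = ∏ i, lawUA p B q D (u i) (D (z i)) := by
  rw [Real.exp_sum, ← Finset.prod_mul_distrib, ← Finset.prod_mul_distrib]
  refine Finset.prod_congr rfl fun i _ => ?_
  have h1 := lawU_pos hp hq (hpos i)
  have h2 := lawUA_pos hp hq D (hpos i)
  have h3 := marg_pos hp.nonneg D (pos_of_joint_pos hp hq (hpos i)).1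
  simp only at h1 h2 h3
  rw [infoDensity, Real.exp_log (by positivity)]
  field_simp

/-- If the empirical information densities are close to their means, then the block is typical. -/
lemma typical_of_infoDensity (hp : IsWeight p) (hq : ∀ t, IsWeight (q t)) (A : Z → X) (C : Z → Y)
    {u : Fin n → U} {z : Fin n → Z} (hpos : ∀ i, 0 < joint p B q (u i, z i)) {a₁ a₂ a₃ a₄ : ℝ}
    (h₁ : a₁ ≤ ∑ i, infoDensity p B q B (u i, z i))
    (h₂ : ∑ i, infoDensity p B q B (u i, z i) ≤ a₂)
    (h₃ : ∑ i, infoDensity p B q A (u i, z i) ≤ a₃)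
    (h₄ : a₄ ≤ ∑ i, infoDensity p B q C (u i, z i)) :
    Typical (prodWeight (Fin n) p) (lift n B) (prodChannel n q) (lift n A) (lift n C)
      (Real.exp a₁) (Real.exp a₂) (Real.exp a₃) (Real.exp a₄) u z := by
  have hU : ∀ i, 0 < lawU p B q (u i) := fun i => lawU_pos hp hq (hpos i)
  have hpU : 0 < ∏ i, lawU p B q (u i) := Finset.prod_pos fun i _ => hU i
  have hB : Real.exp (∑ i, infoDensity p B q B (u i, z i)) * ∏ i, lawU p B q (u i)
      = ∏ i, q (B (z i)) (u i) := by
    rw [Real.exp_sum, ← Finset.prod_mul_distrib]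
    refine Finset.prod_congr rfl fun i _ => ?_
    have h1 := hU i
    have h2 := (pos_of_joint_pos hp hq (hpos i)).2
    rw [infoDensity_self hp hq (hpos i), Real.exp_log (by positivity)]
    field_simp
  have hA := exp_sum_infoDensity n hp hq A hpos
  have hC := exp_sum_infoDensity n hp hq C hpos
  have hmA : 0 ≤ ∏ i, marg p A (A (z i)) :=
    Finset.prod_nonneg fun i _ => marg_nonneg hp.nonneg _ _
  have hmC : 0 ≤ ∏ i, marg p C (C (z i)) :=
    Finset.prod_nonneg fun i _ => marg_nonneg hp.nonneg _ _
  constructor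
  · rwa [lawU_prod]
  · rw [lawU_prod, prodChannel]
    exact (mul_le_mul_of_nonneg_right (Real.exp_le_exp.2 h₁) hpU.le).trans hB.le
  · rw [lawU_prod, prodChannel]
    exact hB.ge.trans (mul_le_mul_of_nonneg_right (Real.exp_le_exp.2 h₂) hpU.le)
  · rw [lawU_prod, lawUA_prod, marg_lift]
    exact hA.ge.trans (mul_le_mul_of_nonneg_right
      (mul_le_mul_of_nonneg_right (Real.exp_le_exp.2 h₃) hpU.le) hmA)
  · rw [lawU_prod, lawUA_prod, marg_lift]
    exact (mul_le_mul_of_nonneg_right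
      (mul_le_mul_of_nonneg_right (Real.exp_le_exp.2 h₄) hpU.le) hmC).trans hC.le

lemma ite_le_sum_ite {w : ℝ} (hw : 0 ≤ w) {P P₁ P₂ P₃ P₄ : Prop} [Decidable P] [Decidable P₁]
    [Decidable P₂] [Decidable P₃] [Decidable P₄] (h : 0 < w → ¬ P → P₁ ∨ P₂ ∨ P₃ ∨ P₄) :
    (if P then 0 else w) ≤
      (if P₁ then w else 0) + (if P₂ then w else 0) +
        ((if P₃ then w else 0) + if P₄ then w else 0) := by
  rcases hw.eq_or_lt with h0 | h0
  · simp [← h0]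
  · split_ifs with hP h1 h2 h3 h4 <;> first | linarith | skip
    exact absurd (h h0 hP) (by tauto)

-- Four Chernoff bounds for sums of information densities: a lower and an upper tail for `B`, the
-- upper one for `A`, the lower one for `C`.
open Classical in
lemma exists_sum_not_typical_le (hp : IsWeight p) (hq : ∀ t, IsWeight (q t)) (A : Z → X)
    (C : Z → Y) {ε : ℝ} (hε : 0 < ε) :
    ∃ d : ℝ, 0 < d ∧ d < 1 ∧ ∀ n : ℕ,
      ∑ ω : (Fin n → U) × (Fin n → Z),
        (if Typical (prodWeight (Fin n) p) (lift n B) (prodChannel n q) (lift n A) (lift n C)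
          (Real.exp (n * (info p B q B - ε))) (Real.exp (n * (info p B q B + ε)))
          (Real.exp (n * (info p B q A + ε))) (Real.exp (n * (info p B q C - ε))) ω.1 ω.2
        then 0 else joint (prodWeight (Fin n) p) (lift n B) (prodChannel n q) ω)
      ≤ 4 * d ^ n := by
  have hj := isWeight_joint hp B hq
  obtain ⟨d₁, h10, h11, h1⟩ := exists_chernoff hj (fun ω => -infoDensity p B q B ω) hε
  obtain ⟨d₂, h20, h21, h2⟩ := exists_chernoff hj (infoDensity p B q B) hε
  obtain ⟨d₃, h30, h31, h3⟩ := exists_chernoff hj (infoDensity p B q A) hε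
  obtain ⟨d₄, h40, h41, h4⟩ := exists_chernoff hj (fun ω => -infoDensity p B q C ω) hε
  simp only [mul_neg, Finset.sum_neg_distrib, sum_infoDensity hp hq] at h1 h2 h3 h4
  -- The entry `1 / 2` only makes `d` positive.
  refine ⟨max (1 / 2) (max (max d₁ d₂) (max d₃ d₄)), by simp, by
    simp only [max_lt_iff]; exact ⟨by norm_num, ⟨h11, h21⟩, h31, h41⟩, fun n => ?_⟩
  set d := max (1 / 2) (max (max d₁ d₂) (max d₃ d₄))
  have g1 := (h1 n).trans (pow_le_pow_left₀ h10 (show d₁ ≤ d by simp [d]) n)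
  have g2 := (h2 n).trans (pow_le_pow_left₀ h20 (show d₂ ≤ d by simp [d]) n)
  have g3 := (h3 n).trans (pow_le_pow_left₀ h30 (show d₃ ≤ d by simp [d]) n)
  have g4 := (h4 n).trans (pow_le_pow_left₀ h40 (show d₄ ≤ d by simp [d]) n)
  rw [← (Equiv.arrowProdEquivProdArrow (Fin n) (fun _ => U) (fun _ => Z)).sum_comp]
  refine le_trans ?_ ((add_le_add (add_le_add g1 g2) (add_le_add g3 g4)).trans
    (le_of_eq (by ring)))
  rw [← Finset.sum_add_distrib, ← Finset.sum_add_distrib, ← Finset.sum_add_distrib]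
  refine Finset.sum_le_sum fun ω _ => ?_
  have hw : joint (prodWeight (Fin n) p) (lift n B) (prodChannel n q)
      (Equiv.arrowProdEquivProdArrow (Fin n) (fun _ => U) (fun _ => Z) ω)
      = prodWeight (Fin n) (joint p B q) ω := by
    simp [Equiv.arrowProdEquivProdArrow, joint_prod, prodWeight]
  rw [hw]
  have h0 : 0 ≤ prodWeight (Fin n) (joint p B q) ω := (isWeight_prodWeight hj).nonneg ω
  refine ite_le_sum_ite h0 fun h0' ht => ?_
  have hpos : ∀ i, 0 < joint p B q (ω i) := fun i =>
    (hj.nonneg _).lt_of_ne fun hz => h0'.ne' (Finset.prod_eq_zero (Finset.mem_univ i) hz.symm)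
  by_contra! hc
  obtain ⟨c1, c2, c3, c4⟩ := hc
  exact ht (typical_of_infoDensity n hp hq A C (u := fun i => (ω i).1) (z := fun i => (ω i).2)
    hpos (by linarith) (by linarith) (by linarith) (by linarith))

end BlockSource

/-! ### Choice of parameters for long blocks -/

section BlockCode

variable {U T Z X Y : Type*} [Fintype U] [Fintype T] [Fintype Z] [Fintype X] [Fintype Y]

lemma natCeil_exp_le {x : ℝ} (hx : 0 ≤ x) : (⌈Real.exp x⌉₊ : ℝ) ≤ 2 * Real.exp x := by
  have h1 := Nat.ceil_lt_add_one (Real.exp_pos x).le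
  have h2 := Real.one_le_exp hx
  linarith

lemma log_three_le_two : Real.log 3 ≤ 2 := by
  have := Real.log_le_sub_one_of_pos (show (0 : ℝ) < 3 by norm_num)
  linarith

lemma log_one_add_two_mul_exp_le {x y : ℝ} (hx : 0 ≤ x) (hy : y ≤ 2 * Real.exp x) (hy0 : 0 ≤ y) :
    Real.log (1 + y) ≤ 2 + x := by
  have h2 := Real.one_le_exp hx
  have h1 : Real.log (1 + y) ≤ Real.log (3 * Real.exp x) :=
    Real.log_le_log (by linarith) (by linarith)
  rw [Real.log_mul (by norm_num) (Real.exp_pos x).ne', Real.log_exp] at h1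
  linarith [log_three_le_two]

open Filter Topology in
/-- Polynomial factors do not matter against a geometric sequence. -/
lemma eventually_geometric_le {ρ : ℝ} (hρ0 : 0 ≤ ρ) (hρ : ρ < 1) (a b c : ℝ) {δ : ℝ} (hδ : 0 < δ) :
    ∀ᶠ n : ℕ in atTop, ρ ^ n * (a + b * n + c * n ^ 2) ≤ δ := by
  have habs : |ρ| < 1 := by rwa [abs_of_nonneg hρ0]
  have h0 := (tendsto_pow_const_mul_const_pow_of_abs_lt_one 0 habs).const_mul a
  have h1 := (tendsto_pow_const_mul_const_pow_of_abs_lt_one 1 habs).const_mul b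
  have h2 := (tendsto_pow_const_mul_const_pow_of_abs_lt_one 2 habs).const_mul c
  have h := (h0.add h1).add h2
  simp only [mul_zero, add_zero] at h
  filter_upwards [h.eventually_le_const hδ] with n hn
  refine le_trans (le_of_eq ?_) hn
  ring

open Classical Filter in
/-- Existence of good codes for all large block lengths. -/
lemma eventually_exists_code {p : Z → ℝ} {B : Z → T} {q : T → U → ℝ} (hp : IsWeight p)
    (hq : ∀ t, IsWeight (q t)) (A : Z → X) (C : Z → Y) {R δ : ℝ} (hR : R < info p B q C)
    (hδ : 0 < δ) :
    ∀ᶠ n : ℕ in atTop, ∀ (MS : ℕ) [NeZero MS], Real.log MS ≤ n * R →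
      ∃ (MW : ℕ) (f : (Fin n → T) → Fin MW × Fin MS) (g : Fin MW × (Fin n → Y) → Fin MS),
        deficit (prodWeight (Fin n) p) (fun z => (f (lift n B z)).1) (lift n A)
          ≤ n * (max 0 (info p B q A - info p B q C) + δ) ∧
        (∑ z, if (f (lift n B z)).2 = g ((f (lift n B z)).1, lift n C z) then 0
          else prodWeight (Fin n) p z) ≤ δ ∧
        deficit (prodWeight (Fin n) p) (fun z => (f (lift n B z)).2)
          (fun z => (f (lift n B z)).1) ≤ δ ∧
        Real.log MW ≤ n * (info p B q B - info p B q C + δ) := by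
  set IT := info p B q B with hIT
  set IX := info p B q A with hIX
  set IY := info p B q C with hIY
  set κ := max 0 (IX - IY) with hκ
  have hκ0 : 0 ≤ κ := le_max_left _ _
  have hκ1 : IX - IY ≤ κ := le_max_right _ _
  have hIT0 : 0 ≤ IT := info_nonneg hp hq B
  have hTY : IY ≤ IT := info_le_info_self hp hq C
  -- `7 ε` turns the exponent `R - IY + 6 ε` of the key bound into at most `-ε`. `12 ε` lets the
  -- excess `6 ε` in the leakage use only half of `δ`.
  obtain ⟨ε, hε, hεR, hεδ⟩ : ∃ ε : ℝ, 0 < ε ∧ 7 * ε ≤ IY - R ∧ 12 * ε ≤ δ := by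
    refine ⟨min ((IY - R) / 7) (δ / 12), lt_min (by linarith) (by linarith), ?_, ?_⟩
    · linarith [min_le_left ((IY - R) / 7) (δ / 12)]
    · linarith [min_le_right ((IY - R) / 7) (δ / 12)]
  obtain ⟨d, hd0, hd1, hd⟩ := exists_sum_not_typical_le (B := B) hp hq A C hε
  rw [← hIT, ← hIX, ← hIY] at hd
  -- With `γ = sⁿ` and `η = 4 dⁿ`, both `γ` and `η / γ` decay like `sⁿ`.
  set s := Real.sqrt d with hs
  have hs0 : 0 < s := Real.sqrt_pos.2 hd0
  have hs1 : s < 1 := by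
    rw [hs, Real.sqrt_lt' one_pos]; simpa using hd1
  have hsd : s ^ 2 = d := Real.sq_sqrt hd0.le
  set ρ := max s (Real.exp (-ε)) with hρ
  have hρ0 : 0 < ρ := hs0.trans_le (le_max_left _ _)
  have hρ1 : ρ < 1 := max_lt hs1 (by rw [Real.exp_lt_one_iff]; linarith)
  -- Of `4 ε`, the codebook size uses `2 ε` and the decoding threshold `ε`. The last `ε` makes the
  -- number of false fits per bin decay.
  set a := IT - IY + 4 * ε with ha
  have ha0 : 0 < a := by rw [ha]; linarith
  -- The first polynomial comes from `8 ρⁿ (2 + n a) + 8 n² ρⁿ`, the second from `2 ρⁿ + 9 ρⁿ (2 + n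
  -- |R|)`.
  filter_upwards [eventually_geometric_le hρ0.le hρ1 16 (8 * a) 8 one_pos,
    eventually_geometric_le hρ0.le hρ1 20 (9 * |R|) 0 hδ,
    eventually_ge_atTop 1, eventually_ge_atTop ⌈6 / δ⌉₊,
    eventually_ge_atTop ⌈(κ + δ) / δ⌉₊] with n hE1 hE2 hn1 hn2 hn3 MS hMS0 hMS
  have hn : (1 : ℝ) ≤ n := by exact_mod_cast hn1
  have hn0 : (0 : ℝ) < n := by linarith
  have hnδ : 6 ≤ n * δ := by
    rw [← div_le_iff₀ hδ]
    exact (Nat.le_ceil _).trans (by exact_mod_cast hn2)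
  have hnκ : κ + δ ≤ n * δ := by
    rw [← div_le_iff₀ hδ]
    exact (Nat.le_ceil _).trans (by exact_mod_cast hn3)
  have hρn : 0 < ρ ^ n := pow_pos hρ0 n
  have hsρ : s ^ n ≤ ρ ^ n := pow_le_pow_left₀ hs0.le (le_max_left _ _) n
  have heρ : Real.exp (-(n * ε)) ≤ ρ ^ n := by
    rw [← mul_neg, Real.exp_nat_mul]
    exact pow_le_pow_left₀ (Real.exp_pos _).le (le_max_right _ _) n
  set M := ⌈Real.exp (n * (IT + 2 * ε))⌉₊ with hM
  set MW := ⌈Real.exp (n * a)⌉₊ with hMW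
  have hM1 : Real.exp (n * (IT + 2 * ε)) ≤ M := Nat.le_ceil _
  have hM2 : (M : ℝ) ≤ 2 * Real.exp (n * (IT + 2 * ε)) := natCeil_exp_le (by positivity)
  have hMW1 : Real.exp (n * a) ≤ MW := Nat.le_ceil _
  have hMW2 : (MW : ℝ) ≤ 2 * Real.exp (n * a) := natCeil_exp_le (by positivity)
  have hMWpos : (0 : ℝ) < MW := (Real.exp_pos _).trans_le hMW1
  have : NeZero MW := ⟨by rintro h; rw [h] at hMWpos; simp at hMWpos⟩
  have hMSpos : (0 : ℝ) < MS := by exact_mod_cast Nat.pos_of_ne_zero (NeZero.ne MS)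
  have hMS2 : (MS : ℝ) ≤ Real.exp (n * R) := by
    rw [← Real.log_le_iff_le_exp hMSpos]; exact hMS
  -- The four terms are at most 4, 1, 2 and 1 times `ρⁿ`.
  have he : 4 * d ^ n / s ^ n + Real.exp (-(M * (1 / Real.exp (n * (IT + ε)))))
      + M / Real.exp (n * (IY - ε)) / MW + s ^ n ≤ 8 * ρ ^ n := by
    have e1 : 4 * d ^ n / s ^ n = 4 * s ^ n := by
      rw [← hsd, ← pow_mul, mul_comm 2 n, pow_mul]
      field_simp
    have e2 : Real.exp (-(M * (1 / Real.exp (n * (IT + ε))))) ≤ Real.exp (-(n * ε)) := by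
      rw [Real.exp_le_exp, neg_le_neg_iff, mul_one_div, le_div_iff₀ (Real.exp_pos _)]
      refine le_trans ?_ hM1
      rw [show n * (IT + 2 * ε) = n * ε + n * (IT + ε) by ring, Real.exp_add]
      refine mul_le_mul_of_nonneg_right ?_ (Real.exp_pos _).le
      linarith [Real.add_one_le_exp (n * ε)]
    have e3 : M / Real.exp (n * (IY - ε)) / MW ≤ 2 * Real.exp (-(n * ε)) := by
      rw [div_div, div_le_iff₀ (by positivity)]
      have h1 : 2 * Real.exp (n * (IT + 2 * ε))
          = 2 * Real.exp (-(n * ε)) * (Real.exp (n * (IY - ε)) * Real.exp (n * a)) := by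
        rw [← Real.exp_add, mul_assoc, ← Real.exp_add]
        congr 2
        rw [ha]; ring
      refine hM2.trans (h1.le.trans ?_)
      have := (Real.exp_pos (n * (IY - ε))).le
      have := (Real.exp_pos (-(n * ε))).le
      gcongr
    linarith
  have hη := hd n
  -- `ν = n²` outweighs the leakage bound, which is linear in `n`, while `n² ρⁿ` still tends to
  -- zero.
  obtain ⟨f, g, h1, h2⟩ := exists_oneShot_code (B := lift n B) (C := lift n C)
    (isWeight_prodWeight hp) (isWeight_prodChannel n hq) (ξ := Real.exp (n * ε))
    (ν := (n : ℝ) ^ 2) (Real.exp_pos _) (Real.exp_pos _) (Real.exp_pos _).le (Real.exp_pos _)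
    (pow_pos hs0 n) (pow_lt_one₀ hs0.le hs1 (by omega)) (Real.exp_pos _) (by positivity)
    hη M MW MS he
  have hpn := isWeight_prodWeight (ι := Fin n) hp
  set err := ∑ z, if (f (lift n B z)).2 = g ((f (lift n B z)).1, lift n C z) then 0
    else prodWeight (Fin n) p z with herr
  have herr0 : 0 ≤ err := Finset.sum_nonneg fun z _ => by split_ifs <;> simp [hpn.nonneg]
  have hL0 := deficit_nonneg hpn (fun z => (f (lift n B z)).1) (lift n A)
  set L := deficit (prodWeight (Fin n) p) (fun z => (f (lift n B z)).1) (lift n A)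
  have hlogMW : Real.log (1 + MW) ≤ 2 + n * a :=
    log_one_add_two_mul_exp_le (by positivity) hMW2 hMWpos.le
  have hlogL : Real.log (1 + MW * (Real.exp (n * (IX + ε)) / Real.exp (n * (IT - ε))))
      ≤ 2 + n * (κ + 6 * ε) := by
    refine log_one_add_two_mul_exp_le (by positivity) ?_ (by positivity)
    rw [← Real.exp_sub]
    refine (mul_le_mul_of_nonneg_right hMW2 (Real.exp_pos _).le).trans ?_
    rw [mul_assoc, ← Real.exp_add]
    refine mul_le_mul_of_nonneg_left (Real.exp_le_exp.2 ?_) (by norm_num)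
    have : n * a + (n * (IX + ε) - n * (IT - ε)) = n * ((IX - IY) + 6 * ε) := by rw [ha]; ring
    rw [this]
    gcongr
  have hmain : L + (n : ℝ) ^ 2 * err ≤ n * (κ + δ) := by
    have e1 : 8 * ρ ^ n * Real.log (1 + MW) ≤ 8 * ρ ^ n * (2 + n * a) := by gcongr
    have e2 : n * (12 * ε) ≤ n * δ := by gcongr
    have e3 : L + (n : ℝ) ^ 2 * err ≤ 2 + n * (κ + 6 * ε) +
        ρ ^ n * (16 + 8 * a * n + 8 * n ^ 2) := by
      calc _ ≤ _ := h1
        _ ≤ 2 + n * (κ + 6 * ε) + 8 * ρ ^ n * (2 + n * a) + n ^ 2 * (8 * ρ ^ n) := by gcongr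
        _ = _ := by ring
    linarith
  refine ⟨MW, f, g, ?_, ?_, ?_, ?_⟩
  · have := mul_nonneg (sq_nonneg (n : ℝ)) herr0
    linarith
  · have e1 : (n : ℝ) ^ 2 * err ≤ n ^ 2 * δ := by
      calc (n : ℝ) ^ 2 * err ≤ n * (κ + δ) := by linarith
        _ ≤ n * (n * δ) := by gcongr
        _ = n ^ 2 * δ := by ring
    exact le_of_mul_le_mul_left e1 (by positivity)
  · refine h2.trans ?_
    have e1 : MS * (MW * Real.exp (n * ε) / Real.exp (n * (IT - ε))) ≤ 2 * ρ ^ n := by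
      calc MS * (MW * Real.exp (n * ε) / Real.exp (n * (IT - ε)))
          ≤ Real.exp (n * R) *
            (2 * Real.exp (n * a) * Real.exp (n * ε) / Real.exp (n * (IT - ε))) := by gcongr
        _ = 2 * Real.exp (n * (R - IY + 6 * ε)) := by
            rw [mul_assoc 2, ← Real.exp_add, mul_div_assoc, ← Real.exp_sub, mul_left_comm,
              ← Real.exp_add]
            congr 2
            rw [ha]; ring
        _ ≤ 2 * Real.exp (-(n * ε)) := by
            rw [← mul_neg]
            gcongr
            linarith
        _ ≤ 2 * ρ ^ n := by gcongr
    have e2 : Real.log (1 + MS * (MW * Real.exp (n * ε) / Real.exp (n * (IT - ε))))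
        ≤ 2 * ρ ^ n := by
      have : 0 ≤ MS * (MW * Real.exp (n * ε) / Real.exp (n * (IT - ε))) := by positivity
      have := Real.log_le_sub_one_of_pos
        (show 0 < 1 + MS * (MW * Real.exp (n * ε) / Real.exp (n * (IT - ε))) by linarith)
      linarith
    have e3 : Real.log (1 + MS) ≤ 2 + n * |R| := by
      refine log_one_add_two_mul_exp_le (by positivity) ?_ hMSpos.le
      have : Real.exp (n * R) ≤ Real.exp (n * |R|) := by
        gcongr
        exact le_abs_self R
      linarith [Real.exp_pos (n * |R|)]
    have e4 : 1 / Real.exp (n * ε) ≤ ρ ^ n := by rwa [one_div, ← Real.exp_neg]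
    have e5 : (8 * ρ ^ n + 1 / Real.exp (n * ε)) * Real.log (1 + MS)
        ≤ (9 * ρ ^ n) * (2 + n * |R|) := by
      have : 0 ≤ Real.log (1 + (MS : ℝ)) := Real.log_nonneg (by linarith)
      refine mul_le_mul (by linarith) e3 this (by positivity)
    calc _ ≤ 2 * ρ ^ n + (9 * ρ ^ n) * (2 + n * |R|) := add_le_add e2 e5
      _ = ρ ^ n * (20 + 9 * |R| * n + 0 * n ^ 2) := by ring
      _ ≤ δ := hE2
  · have e1 : Real.log MW ≤ Real.log (1 + MW) := Real.log_le_log hMWpos (by linarith)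
    have e2 : n * (12 * ε) ≤ n * δ := by gcongr
    have e3 : n * a = n * (IT - IY) + n * (4 * ε) := by rw [ha]; ring
    have e4 : n * (IT - IY + δ) = n * (IT - IY) + n * δ := by ring
    linarith

end BlockCode

/-! ### The trivial code -/

section UniqueValues

variable {Ω α β : Type*} [Fintype Ω] [Fintype α] [Fintype β]

lemma ent_unique [Unique α] {p : Ω → ℝ} (hp : IsWeight p) (A : Ω → α) : ent p A = 0 := by
  have h := (hp.marg A).sum_eq
  rw [Fintype.sum_unique] at h
  rw [ent, Fintype.sum_unique, h, Real.negMulLog_one]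

lemma ent_pair_unique [Unique β] (p : Ω → ℝ) (A : Ω → α) (B : Ω → β) :
    ent p (fun ω => (A ω, B ω)) = ent p A := by
  rw [← ent_comp_equiv p (fun ω => (A ω, B ω)) (Equiv.prodUnique α β)]
  rfl

lemma meetsConstraints_trivial {X : Type*} [Fintype X] (P : PMF Ω) {n : ℕ} (Xn : Ω → Fin n → X)
    (S S' W : Ω → Fin 1) {R : ℝ × ℝ × ℝ} (h1 : R.1 = 0) (h2 : 0 ≤ R.2.1) (h3 : 0 ≤ R.2.2) {δ : ℝ}
    (hδ : 0 < δ) : MeetsConstraints P Xn S S' W R δ := by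
  have hp := isWeight_wt P
  refine ⟨by simp [h1], ?_, ?_, ?_, ?_, ?_⟩
  · rw [prob_eq]
    have : ∀ ω, S ω = S' ω := fun _ => Subsingleton.elim _ _
    simp [this, hδ.le]
  · rw [mutualInfo_eq, ent_pair_unique, ent_unique hp W]
    simpa using hδ.le
  · rw [mutualInfo_eq, ent_pair_unique, ent_unique hp W]
    simpa using add_nonneg h2 hδ.le
  · rw [rvEntropy_eq, ent_unique hp, h1]
    simpa using hδ.le
  · simpa using add_nonneg h3 hδ.le

end UniqueValues

/-! ### What the entropy deficit controls -/

section Deficit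

variable {Ω σ ζ : Type*} [Fintype Ω] [Fintype σ] [Fintype ζ]

/-- The deficit is the sum of I(S;Z) and `log |σ| - H(S)`, both nonnegative. Hence it bounds secrecy
and non-uniformity at once. -/
lemma info_le_deficit {p : Ω → ℝ} (hp : IsWeight p) (S : Ω → σ) (Z : Ω → ζ) :
    ent p S + ent p Z - ent p (fun ω => (S ω, Z ω)) ≤ deficit p S Z := by
  have := ent_le_log_card hp S
  rw [deficit]
  linarith

lemma info_swap_le_deficit {p : Ω → ℝ} (hp : IsWeight p) (S : Ω → σ) (Z : Ω → ζ) :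
    ent p Z + ent p S - ent p (fun ω => (Z ω, S ω)) ≤ deficit p S Z := by
  rw [ent_swap, add_comm]
  exact info_le_deficit hp S Z

lemma log_card_sub_deficit_le {p : Ω → ℝ} (hp : IsWeight p) (S : Ω → σ) (Z : Ω → ζ) :
    Real.log (Fintype.card σ) - deficit p S Z ≤ ent p S := by
  have := ent_pair_le hp S Z
  rw [deficit]
  linarith

end Deficit

/-! ### Chosen secrets through a one-time pad -/

section OneTimePad

variable {Ω α : Type*} [Fintype Ω] [Fintype α] {M : ℕ} [NeZero M]

/-- The weight of an independent uniformly distributed key added to the weight `p`. -/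
def withKey (M : ℕ) (p : Ω → ℝ) (ω : Ω × Fin M) : ℝ := p ω.1 * (1 / M)

lemma natCast_pos_of_neZero : (0 : ℝ) < M := by
  exact_mod_cast Nat.pos_of_ne_zero (NeZero.ne M)

lemma sum_withKey_mul (p : Ω → ℝ) (f : Ω → ℝ) :
    ∑ ω, withKey M p ω * f ω.1 = ∑ ω, p ω * f ω := by
  have hM := natCast_pos_of_neZero (M := M)
  rw [Fintype.sum_prod_type]
  refine Finset.sum_congr rfl fun ω _ => ?_
  simp only [withKey, Finset.sum_const, Finset.card_univ, Fintype.card_fin, nsmul_eq_mul]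
  field_simp

lemma ent_withKey_fst (p : Ω → ℝ) (A : Ω → α) :
    ent (withKey M p) (fun ω => A ω.1) = ent p A := by
  classical
  have h : ∀ a, marg (withKey M p) (fun ω => A ω.1) a = marg p A a := fun a => by
    have := sum_withKey_mul (M := M) p fun ω => if A ω = a then 1 else 0
    simpa [marg] using this
  simp_rw [ent, h]

/-- A sum with an independent uniform key is uniform and independent of everything but the key. -/
lemma ent_withKey_add {p : Ω → ℝ} (hp : IsWeight p) (A : Ω → α) (h : Ω → Fin M) :
    ent (withKey M p) (fun ω => (A ω.1, h ω.1 + ω.2)) = ent p A + Real.log M := by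
  classical
  have hM := natCast_pos_of_neZero (M := M)
  have h1 : ∀ a t, marg (withKey M p) (fun ω => (A ω.1, h ω.1 + ω.2)) (a, t)
      = marg p A a * (1 / M) := fun a t => by
    rw [marg, Fintype.sum_prod_type, marg, Finset.sum_mul]
    refine Finset.sum_congr rfl fun ω _ => ?_
    by_cases ha : A ω = a
    · have : ∀ s : Fin M, h ω + s = t ↔ s = t - h ω := fun s => by
        rw [eq_sub_iff_add_eq, add_comm]
      simp [ha, this, withKey]
    · simp [ha]
  rw [ent_eq, ent_eq]
  simp_rw [h1]
  have h2 : ∀ ω : Ω × Fin M, withKey M p ω * Real.log (marg p A (A ω.1) * (1 / M))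
      = withKey M p ω * (Real.log (marg p A (A ω.1)) - Real.log M) := fun ω => by
    rcases (hp.nonneg ω.1).eq_or_lt with h0 | h0
    · simp [withKey, ← h0]
    · have h3 := marg_pos hp.nonneg A h0
      rw [Real.log_mul h3.ne' (by positivity), Real.log_div one_ne_zero hM.ne', Real.log_one]
      ring
  simp_rw [h2]
  rw [sum_withKey_mul p fun ω => Real.log (marg p A (A ω)) - Real.log M]
  simp_rw [mul_sub]
  rw [Finset.sum_sub_distrib, ← Finset.sum_mul, hp.sum_eq]
  ring

lemma ent_withKey_snd {p : Ω → ℝ} (hp : IsWeight p) :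
    ent (withKey M p) (fun ω => ω.2) = Real.log M := by
  have h := ent_withKey_add (M := M) hp (fun _ => ()) fun _ => 0
  rw [ent_unique hp, zero_add] at h
  rw [← h, ← ent_comp_equiv _ (fun ω : Ω × Fin M => ((), (0 : Fin M) + ω.2))
    (Equiv.punitProd (Fin M))]
  simp

variable {MW : ℕ}

/-- Helper data of the one-time pad: `(w, s + k)`. -/
def pad (W : Ω → Fin MW) (S : Ω → Fin M) (ω : Ω × Fin M) : Fin (MW * M) :=
  finProdFinEquiv (W ω.1, S ω.1 + ω.2)

lemma ent_pad {p : Ω → ℝ} (hp : IsWeight p) (W : Ω → Fin MW) (S : Ω → Fin M) :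
    ent (withKey M p) (pad W S) = ent p W + Real.log M := by
  rw [← ent_withKey_add hp W S]
  exact ent_comp_equiv _ (fun ω : Ω × Fin M => (W ω.1, S ω.1 + ω.2)) finProdFinEquiv

/-- Together with `ent_pad` this shows that the padded helper data carries exactly as much
information on `A` as `W` does. -/
lemma ent_pair_pad {p : Ω → ℝ} (hp : IsWeight p) (A : Ω → α) (W : Ω → Fin MW) (S : Ω → Fin M) :
    ent (withKey M p) (fun ω => (A ω.1, pad W S ω))
      = ent p (fun ω => (A ω, W ω)) + Real.log M := by
  rw [← ent_withKey_add hp (fun ω => (A ω, W ω)) S]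
  exact ent_comp_equiv _ (fun ω : Ω × Fin M => ((A ω.1, W ω.1), S ω.1 + ω.2))
    ((Equiv.prodAssoc α (Fin MW) (Fin M)).trans ((Equiv.refl α).prodCongr finProdFinEquiv))

/-- The triples (S, W, K) and (K, W, S + K) determine each other, and K is independent of (S, W).
Hence the information of the padded helper data on K is exactly the deficit of S given W. -/
lemma ent_key_pad {p : Ω → ℝ} (hp : IsWeight p) (W : Ω → Fin MW) (S : Ω → Fin M) :
    ent (withKey M p) (fun ω => (ω.2, pad W S ω))
      = ent p (fun ω => (S ω, W ω)) + Real.log M := by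
  rw [← ent_withKey_add hp (fun ω => (S ω, W ω)) fun _ => 0]
  let e : (Fin M × Fin MW) × Fin M ≃ Fin M × Fin (MW * M) :=
    { toFun := fun x => (x.2, finProdFinEquiv (x.1.2, x.1.1 + x.2))
      invFun := fun y => (((finProdFinEquiv.symm y.2).2 - y.1, (finProdFinEquiv.symm y.2).1), y.1)
      left_inv := fun x => by simp
      right_inv := fun y => by
        refine Prod.ext rfl ?_
        simp only [sub_add_cancel]
        exact finProdFinEquiv.apply_symm_apply y.2 }
  rw [← ent_comp_equiv _ (fun ω : Ω × Fin M => ((S ω.1, W ω.1), (0 : Fin M) + ω.2)) e]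
  simp [e, pad]

end OneTimePad

/-! ### Achievable tuples and their closure -/

section Achievability

variable {X Xt Y : Type*} [Fintype X] [Fintype Xt] [Fintype Y]
variable (PX : PMF X) (BC : X → PMF (Xt × Y))

lemma wt_iid_eq {α : Type*} [Fintype α] (p : PMF α) (n : ℕ) :
    wt (iid p n) = prodWeight (Fin n) (wt p) :=
  funext fun z => wt_iid p n z

lemma wt_chosenLaw (n MS : ℕ) [NeZero MS] :
    wt (chosenLaw PX BC n MS) = withKey MS (prodWeight (Fin n) (wt (sourceLaw PX BC))) := by
  classical
  ext ⟨z, s⟩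
  rw [chosenLaw, wt_bind, Finset.sum_eq_single z]
  · rw [wt_map, wt_iid]
    simp [marg, withKey, prodWeight, wt]
  · intro z' _ h
    rw [wt_map]; simp [marg, h]
  · simp

lemma infoUX_eq {m : ℕ} (Q : Xt → PMF (Fin m)) :
    infoUX PX BC Q = info (wt (sourceLaw PX BC)) (fun z => z.2.1) (fun t => wt (Q t))
      fun z => z.1 := by
  rw [infoUX, mutualInfo_eq, wt_auxLaw]; rfl

lemma infoUXt_eq {m : ℕ} (Q : Xt → PMF (Fin m)) :
    infoUXt PX BC Q = info (wt (sourceLaw PX BC)) (fun z => z.2.1) (fun t => wt (Q t))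
      fun z => z.2.1 := by
  rw [infoUXt, mutualInfo_eq, wt_auxLaw]; rfl

lemma infoUY_eq {m : ℕ} (Q : Xt → PMF (Fin m)) :
    infoUY PX BC Q = info (wt (sourceLaw PX BC)) (fun z => z.2.1) (fun t => wt (Q t))
      fun z => z.2.2 := by
  rw [infoUY, mutualInfo_eq, wt_auxLaw]; rfl

lemma infoUY_le_infoUXt {m : ℕ} (Q : Xt → PMF (Fin m)) : infoUY PX BC Q ≤ infoUXt PX BC Q := by
  rw [infoUY_eq, infoUXt_eq]
  exact info_le_info_self (isWeight_wt _) (fun t => isWeight_wt _) _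

open Classical in
/-- For every rational key rate (in bits) below `I(U;Y)` there are codes with exactly this rate. -/
lemma exists_code_of_rate {m : ℕ} (Q : Xt → PMF (Fin m)) {a b : ℕ} (hb : 1 ≤ b)
    (hr : (a : ℝ) / b * Real.log 2 < infoUY PX BC Q) {δ : ℝ} (hδ : 0 < δ) :
    ∃ (n MW MS : ℕ), 1 ≤ n ∧ 1 ≤ MS ∧ (a : ℝ) / b * Real.log 2 = Real.log MS / n ∧
      ∃ (f : (Fin n → Xt) → Fin MW × Fin MS) (g : Fin MW × (Fin n → Y) → Fin MS),
        deficit (prodWeight (Fin n) (wt (sourceLaw PX BC))) (fun z => (f fun i => (z i).2.1).1)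
            (fun z i => (z i).1) / n
          ≤ max 0 (infoUX PX BC Q - infoUY PX BC Q) + δ ∧
        (∑ z, if (f fun i => (z i).2.1).2 = g ((f fun i => (z i).2.1).1, fun i => (z i).2.2) then 0
          else prodWeight (Fin n) (wt (sourceLaw PX BC)) z) ≤ δ ∧
        deficit (prodWeight (Fin n) (wt (sourceLaw PX BC))) (fun z => (f fun i => (z i).2.1).2)
          (fun z => (f fun i => (z i).2.1).1) ≤ δ ∧
        Real.log MW / n ≤ infoUXt PX BC Q - infoUY PX BC Q + δ := by
  rw [infoUY_eq] at hr
  have h := eventually_exists_code (isWeight_wt (sourceLaw PX BC)) (fun t => isWeight_wt (Q t))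
    (fun z => z.1) (fun z => z.2.2) hr hδ
  rw [← infoUX_eq, ← infoUY_eq, ← infoUXt_eq] at h
  obtain ⟨N, hN⟩ := Filter.eventually_atTop.1 h
  set k := N + 1
  have hb0 : (0 : ℝ) < b := by exact_mod_cast hb
  have hk0 : (0 : ℝ) < k := by positivity
  have hn0 : (0 : ℝ) < (b * k : ℕ) := by push_cast; positivity
  -- Block length `b k` with key size `2 ^ (a k)` has rate exactly `(a / b) log 2` for every `k`, as
  -- achievability fixes the rate before `δ`.
  have hlog : Real.log ((2 ^ (a * k) : ℕ) : ℝ) = (b * k : ℕ) * (a / b * Real.log 2) := by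
    push_cast
    rw [Real.log_pow]
    push_cast
    field_simp
  have : NeZero (2 ^ (a * k)) := ⟨by positivity⟩
  obtain ⟨MW, f, g, h1, h2, h3, h4⟩ := hN (b * k)
    ((Nat.le_succ N).trans (Nat.le_mul_of_pos_left _ hb)) (2 ^ (a * k)) hlog.le
  refine ⟨b * k, MW, 2 ^ (a * k), ?_, Nat.one_le_two_pow, ?_, f, g, ?_, h2, h3, ?_⟩
  · exact Nat.mul_pos hb (Nat.succ_pos N)
  · rw [hlog]; field_simp
  · rw [div_le_iff₀ hn0]; exact h1.trans_eq (mul_comm _ _)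
  · rw [div_le_iff₀ hn0]; exact h4.trans_eq (mul_comm _ _)

lemma achievableGS_of_rate {m : ℕ} (Q : Xt → PMF (Fin m)) {a b : ℕ} (hb : 1 ≤ b) {R : ℝ × ℝ × ℝ}
    (hR : R ∈ ratesGS PX BC Q) (hr : (a : ℝ) / b * Real.log 2 < R.1) :
    AchievableGS PX BC ((a : ℝ) / b * Real.log 2, R.2) := by
  classical
  intro δ hδ
  obtain ⟨n, MW, MS, hn, -, hrate, f, g, h1, h2, h3, h4⟩ :=
    exists_code_of_rate PX BC Q hb (hr.trans_le hR.2.1) hδ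
  have hp := isWeight_prodWeight (ι := Fin n) (isWeight_wt (sourceLaw PX BC))
  have hn1 : (1 : ℝ) ≤ n := by exact_mod_cast hn
  have hn0 : (0 : ℝ) < n := by linarith
  refine ⟨n, MW, MS, hn, f, g, hrate, ?_, ?_, ?_, ?_, ?_⟩
  · rw [prob_eq, wt_iid_eq]
    refine le_trans (le_of_eq (Finset.sum_congr rfl fun z _ => ?_)) h2
    simp only [Set.mem_ofPred_eq]
    split_ifs <;> simp_all
  · rw [mutualInfo_eq, wt_iid_eq]
    exact (info_le_deficit hp _ _).trans h3
  · have h5 := info_swap_le_deficit hp (fun z => (f fun i => (z i).2.1).1) (fun z i => (z i).1)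
    rw [mutualInfo_eq, wt_iid_eq]
    have h6 := div_le_div_of_nonneg_right h5 hn0.le
    have h7 := hR.2.2.1
    simp only
    linarith
  · have h5 := log_card_sub_deficit_le hp (fun z => (f fun i => (z i).2.1).2)
      (fun z => (f fun i => (z i).2.1).1)
    rw [Fintype.card_fin] at h5
    rw [rvEntropy_eq, wt_iid_eq]
    simp only
    rw [hrate, sub_le_iff_le_add, div_le_iff₀ hn0, add_mul, div_mul_cancel₀ _ hn0.ne']
    nlinarith
  · have h7 := hR.2.2.2
    simp only
    linarith

/-- The generated key masks the chosen one, and the decoder subtracts its estimate. Storage grows by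
the key rate, which is below I(U;Y), so I(U;X̃) suffices. -/
lemma achievableCS_of_rate {m : ℕ} (Q : Xt → PMF (Fin m)) {a b : ℕ} (hb : 1 ≤ b) {R : ℝ × ℝ × ℝ}
    (hR : R ∈ ratesCS PX BC Q) (hr : (a : ℝ) / b * Real.log 2 < R.1) :
    AchievableCS PX BC ((a : ℝ) / b * Real.log 2, R.2) := by
  classical
  intro δ hδ
  obtain ⟨n, MW, MS, hn, hMS, hrate, f, g, h1, h2, h3, h4⟩ :=
    exists_code_of_rate PX BC Q hb (hr.trans_le hR.2.1) hδ
  have hp := isWeight_prodWeight (ι := Fin n) (isWeight_wt (sourceLaw PX BC))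
  have hn1 : (1 : ℝ) ≤ n := by exact_mod_cast hn
  have hn0 : (0 : ℝ) < n := by linarith
  have hNZ : NeZero MS := ⟨by omega⟩
  obtain ⟨z₀⟩ := hp.nonempty
  have hMW : MW ≠ 0 := by
    have := (f fun i => (z₀ i).2.1).1.pos
    omega
  set pn := prodWeight (Fin n) (wt (sourceLaw PX BC))
  set Xn : (Fin n → X × Xt × Y) → Fin n → X := fun z i => (z i).1
  set W : (Fin n → X × Xt × Y) → Fin MW := fun z => (f fun i => (z i).2.1).1
  set S : (Fin n → X × Xt × Y) → Fin MS := fun z => (f fun i => (z i).2.1).2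
  refine ⟨n, MW * MS, MS, hNZ, hn,
    fun x => finProdFinEquiv ((f x.1).1, (f x.1).2 + x.2),
    fun y => (finProdFinEquiv.symm y.1).2 - g ((finProdFinEquiv.symm y.1).1, y.2),
    hrate, ?_, ?_, ?_, ?_, ?_⟩
  · rw [prob_eq, wt_chosenLaw]
    have h5 := sum_withKey_mul (M := MS) pn
      fun z => if S z = g (W z, fun i => (z i).2.2) then 0 else 1
    have h6 : ∑ z, pn z *
        (if S z = g (W z, fun i => (z i).2.2) then (0 : ℝ) else 1) ≤ δ := by
      simpa only [mul_ite, mul_zero, mul_one] using h2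
    rw [← h5] at h6
    refine le_trans (le_of_eq (Finset.sum_congr rfl fun ω _ => ?_)) h6
    have h7 : ω.2 = S ω.1 + ω.2 - g (W ω.1, fun i => (ω.1 i).2.2)
        ↔ S ω.1 = g (W ω.1, fun i => (ω.1 i).2.2) := by
      rw [eq_sub_iff_add_eq, add_comm, add_left_inj, eq_comm]
    simp only [Set.mem_ofPred_eq, Equiv.symm_apply_apply, ne_eq]
    change (if ¬ ω.2 = S ω.1 + ω.2 - g (W ω.1, fun i => (ω.1 i).2.2) then _ else _) = _
    by_cases hS : S ω.1 = g (W ω.1, fun i => (ω.1 i).2.2)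
    · rw [if_neg (not_not.2 (h7.2 hS)), if_pos hS, mul_zero]
    · rw [if_pos fun h => hS (h7.1 h), if_neg hS, mul_one]
  · rw [mutualInfo_eq, wt_chosenLaw]
    have h5 : ent (withKey MS pn) (fun ω => ω.2) + ent (withKey MS pn) (pad W S)
        - ent (withKey MS pn) (fun ω => (ω.2, pad W S ω)) ≤ δ := by
      rw [ent_withKey_snd hp, ent_pad hp, ent_key_pad hp]
      rw [deficit, Fintype.card_fin] at h3
      linarith
    exact h5
  · rw [mutualInfo_eq, wt_chosenLaw]
    have h5 : (ent (withKey MS pn) (fun ω => Xn ω.1) + ent (withKey MS pn) (pad W S)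
        - ent (withKey MS pn) (fun ω => (Xn ω.1, pad W S ω))) / n ≤ R.2.1 + δ := by
      rw [ent_withKey_fst, ent_pad hp, ent_pair_pad hp, ← add_assoc, add_sub_add_right_eq_sub]
      have h6 := div_le_div_of_nonneg_right (info_swap_le_deficit hp W Xn) hn0.le
      have h7 := hR.2.2.1
      linarith
    exact h5
  · rw [rvEntropy_eq, wt_chosenLaw, ent_withKey_snd hp, ← hrate]
    simp only
    linarith
  · have h7 := hR.2.2.2
    have h8 := hR.2.1
    rw [Nat.cast_mul, Real.log_mul (by exact_mod_cast hMW) (by exact_mod_cast NeZero.ne MS),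
      add_div, ← hrate]
    simp only
    linarith

/-- Rational multiples of `log 2` approximate a positive rate from below. -/
lemma exists_rate_near {r ε : ℝ} (hr : 0 < r) (hε : 0 < ε) :
    ∃ a b : ℕ, 1 ≤ b ∧ (a : ℝ) / b * Real.log 2 < r ∧ r - ε < (a : ℝ) / b * Real.log 2 := by
  have hl : 0 < Real.log 2 := Real.log_pos (by norm_num)
  obtain ⟨x, hx1, hx2⟩ := exists_rat_btwn (show max 0 (r - ε) / Real.log 2 < r / Real.log 2 from
    div_lt_div_of_pos_right (max_lt hr (by linarith)) hl)
  rw [div_lt_iff₀ hl] at hx1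
  rw [lt_div_iff₀ hl] at hx2
  have hx0 : (0 : ℝ) ≤ x := by
    by_contra hneg
    have := mul_neg_of_neg_of_pos (not_le.1 hneg) hl
    linarith [le_max_left 0 (r - ε)]
  have hnum : 0 ≤ x.num := Rat.num_nonneg.2 (by exact_mod_cast hx0)
  have hxe : ((x.num.toNat : ℕ) : ℝ) / x.den = x := by
    have h1 : ((x.num.toNat : ℕ) : ℝ) = (x.num : ℝ) := by
      exact_mod_cast congrArg (Int.cast : ℤ → ℝ) (Int.toNat_of_nonneg hnum)
    rw [h1]
    exact_mod_cast Rat.num_div_den x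
  refine ⟨x.num.toNat, x.den, x.den_pos, ?_, ?_⟩
  · rwa [hxe]
  · rw [hxe]; linarith [le_max_right 0 (r - ε)]

/-- Only particular key rates can equal `log |S| / n`. Rational multiples of `log 2` are dense, and
the closure supplies the rest. -/
lemma mem_closure_of_rates {s : Set (ℝ × ℝ × ℝ)} {R : ℝ × ℝ × ℝ} (hR : 0 < R.1)
    (h : ∀ a b : ℕ, 1 ≤ b → (a : ℝ) / b * Real.log 2 < R.1 →
      ((a : ℝ) / b * Real.log 2, R.2) ∈ s) : R ∈ closure s := by
  rw [Metric.mem_closure_iff]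
  intro ε hε
  obtain ⟨a, b, hb, h1, h2⟩ := exists_rate_near hR hε
  refine ⟨_, h a b hb h1, ?_⟩
  rw [Prod.dist_eq, dist_self, Real.dist_eq, abs_of_pos (by linarith)]
  exact max_lt (by linarith) hε

theorem regionGS_subset_capacityGS : regionGS PX BC ⊆ capacityGS PX BC := by
  intro R hR
  simp only [regionGS, Set.mem_iUnion] at hR
  obtain ⟨m, Q, hR⟩ := hR
  rcases hR.1.eq_or_lt with h0 | h0
  -- No nonnegative rate lies strictly below zero, so zero key rate is served by one-letter
  -- alphabets. The storage rate is nonnegative by data processing.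
  · refine subset_closure fun δ hδ => ⟨1, 1, 1, le_rfl, fun _ => (0, 0), fun _ => 0, ?_⟩
    exact meetsConstraints_trivial _ _ _ _ _ h0.symm ((le_max_left _ _).trans hR.2.2.1)
      ((sub_nonneg.2 (infoUY_le_infoUXt PX BC Q)).trans hR.2.2.2) hδ
  · exact mem_closure_of_rates h0 fun a b hb hr => achievableGS_of_rate PX BC Q hb hR hr

theorem regionCS_subset_capacityCS : regionCS PX BC ⊆ capacityCS PX BC := by
  intro R hR
  simp only [regionCS, Set.mem_iUnion] at hR
  obtain ⟨m, Q, hR⟩ := hR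
  rcases hR.1.eq_or_lt with h0 | h0
  · refine subset_closure fun δ hδ => ⟨1, 1, 1, inferInstance, le_rfl, fun _ => 0, fun _ => 0, ?_⟩
    refine meetsConstraints_trivial _ _ _ _ _ h0.symm ((le_max_left _ _).trans hR.2.2.1) ?_ hδ
    linarith [infoUY_le_infoUXt PX BC Q, hR.2.1, hR.2.2.2, hR.1]
  · exact mem_closure_of_rates h0 fun a b hb hr => achievableCS_of_rate PX BC Q hb hR hr

end Achievability

end KeyAgreement

end

open KeyAgreement in
theorem theorem1 {X Xt Y : Type*} [Fintype X] [Fintype Xt] [Fintype Y]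
    (PX : PMF X) (BC : X → PMF (Xt × Y)) :
    -- inner bounds
    regionGS PX BC ⊆ capacityGS PX BC ∧
    regionCS PX BC ⊆ capacityCS PX BC ∧
    -- `|U| ≤ |X̃| + 2` suffices
    region1 PX BC ⊤ = region1 PX BC (Fintype.card Xt + 2) ∧
    region3 PX BC ⊤ = region3 PX BC (Fintype.card Xt + 2) ∧
    region2 PX BC ⊤ = region2 PX BC (Fintype.card Xt + 2) ∧
    region4 PX BC ⊤ = region4 PX BC (Fintype.card Xt + 2) ∧
    -- `|U| ≤ |X̃| + 1` suffices to preserve the bounds on the key and storage rates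
    (∀ (m : ℕ) (Q : Xt → PMF (Fin m)),
      ∃ m' ≤ Fintype.card Xt + 1, ∃ Q' : Xt → PMF (Fin m'),
        infoUY PX BC Q' = infoUY PX BC Q ∧ infoUXt PX BC Q' = infoUXt PX BC Q) ∧
    -- `|U| ≤ |X̃| + 1` suffices if the leakage bound is zero for every `P_{U|X̃}`
    ((∀ (m : ℕ) (Q : Xt → PMF (Fin m)), infoUX PX BC Q ≤ infoUY PX BC Q) →
      region2 PX BC ⊤ = region2 PX BC (Fintype.card Xt + 1) ∧
      region4 PX BC ⊤ = region4 PX BC (Fintype.card Xt + 1)) := by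
  exact ⟨regionGS_subset_capacityGS PX BC, regionCS_subset_capacityCS PX BC, region1_eq PX BC,
    region3_eq PX BC, region2_eq PX BC, region4_eq PX BC,
    fun _ Q => exists_alphabet_preserving_key_storage PX BC Q,
    fun h => ⟨region2_eq_of_le PX BC h, region4_eq_of_le PX BC h⟩⟩
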